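/- **Conventions.** The Cantor space $2^\omega$ of all infinite $0$-$1$ sequences carries the product topology and coordinatewise addition modulo $2$; for $B\subseteq 2^\omega$ and $x\in 2^\omega$ let $B+x=\{b+x:b\in B\}$. A perfect set is a non-empty closed set without isolated points. For a cardinal $1\le k\le 2^{\aleph_0}$, a set $B\subseteq 2^\omega$ is a *$k$-**npots**-set* if there is no perfect set $P\subseteq 2^\omega$ such that $|(B+x)\cap(B+y)|\ge k$ for all $x,y\in P$. The set $B$ *has $\lambda$ many pairwise $k$-nondisjoint translations* if there is a set $X\subseteq 2^\omega$ of cardinality $\lambda$ such that $|(B+x)\cap(B+y)|\ge k$ for all $x,y\in X$. **The rank.** Let $\mathbb M$ be a model with universe $\lambda$ (a cardinal) and a countable vocabulary. For finite non-empty $w=\{a_0,\dots,a_n\}\subseteq\lambda$ with $|w|=n+1$, the relation $\mathrm{rk}(w,\mathbb M)\ge\alpha$ is defined by induction on the ordinal $\alpha$: * $\mathrm{rk}(w,\mathbb M)\ge 0$ iff for every quantifier free formula $\varphi$ and every $k\le n$, if $\mathbb M\models\varphi[a_0,\dots,a_k,\dots,a_n]$ then the set $\{a\in\lambda:\mathbb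 M\models\varphi[a_0,\dots,a_{k-1},a,a_{k+1},\dots,a_n]\}$ is uncountable; * for limit $\alpha$, $\mathrm{rk}(w,\mathbb M)\ge\alpha$ iff $\mathrm{rk}(w,\mathbb M)\ge\beta$ for all $\beta<\alpha$; * $\mathrm{rk}(w,\mathbb M)\ge\alpha+1$ iff for every quantifier free formula $\varphi$ and every $k\le n$, if $\mathbb M\models\varphi[a_0,\dots,a_k,\dots,a_n]$ then there is $a^*\in\lambda\setminus w$ such that $\mathrm{rk}(w\cup\{a^*\},\mathbb M)\ge\alpha$ and $\mathbb M\models\varphi[a_0,\dots,a_{k-1},a^*,a_{k+1},\dots,a_n]$. Then $\mathrm{rk}(w,\mathbb M)$ is $-1$ if $\mathrm{rk}(w,\mathbb M)\not\ge 0$; it is $\infty$ if $\mathrm{rk}(w,\mathbb M)\ge\alpha$ for all ordinals $\alpha$; and otherwise it is the ordinal $\alpha$ with $\mathrm{rk}(w,\mathbb M)\ge\alpha$ and $\mathrm{rk}(w,\mathbb M)\not\ge\alpha+1$. For an ordinal $\varepsilon$, $\mathrm{NPr}_\varepsilon(\lambda)$ is the statement: there is a model $\mathbb M$ with universe $\lambda$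 and a countable vocabulary such that $\sup\{\mathrm{rk}(w,\mathbb M):\emptyset\ne w\subseteq\lambda \text{ finite}\}<\varepsilon$. **Statement.** Assume Martin's axiom and the negation of the continuum hypothesis. Let $\lambda<2^{\aleph_0}$ be a cardinal such that $\mathrm{NPr}_{\omega_1}(\lambda)$ holds, and let $3\le\iota<\omega$. Then there is a $\Sigma^0_2$ set $B\subseteq 2^\omega$ which is a $2\iota$-**npots**-set and which has $\lambda$ many pairwise $2\iota$-nondisjoint translations. -/

import Mathlib

open Set Cardinal

open scoped Ordinal

/-! ### Continuum hypothesis and Martin's axiom -/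

/-- The continuum hypothesis `2 ^ ℵ₀ = ℵ₁`. -/
def ContinuumHypothesis : Prop :=
  𝔠 = (ℵ₁ : Cardinal.{0})

/-- Two forcing conditions are compatible if they have a common extension. By convention,
the stronger condition is the larger one. -/
def ForcingCompatible {P : Type} [Preorder P] (p q : P) : Prop :=
  ∃ r, p ≤ r ∧ q ≤ r

/-- The countable chain condition: every antichain (set of pairwise incompatible conditions) is
countable. -/
def ForcingCCC (P : Type) [Preorder P] : Prop :=
  ∀ A : Set P, A.Pairwise (fun p q => ¬ ForcingCompatible p q) → A.Countable

/-- Martin's axiom: for every non-empty ccc forcing notion `P` and every family `𝒟` of fewer than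
`2 ^ ℵ₀` dense subsets of `P` there is a filter `G` in `P` which meets every member of `𝒟`.
With the convention that stronger conditions are larger, dense sets are the cofinal sets, and a
filter is a non-empty, upward directed, downward closed subset, that is, an `Order.Ideal`. -/
def MartinsAxiom : Prop :=
  ∀ (P : Type) [Preorder P] [Nonempty P], ForcingCCC P →
    ∀ 𝒟 : Set (Set P), #𝒟 < 𝔠 → (∀ D ∈ 𝒟, IsCofinal D) →
      ∃ G : Order.Ideal P, ∀ D ∈ 𝒟, ∃ p ∈ D, p ∈ G

/-! ### The rank on finite sets of elements of a model -/

section Rank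

variable (L : FirstOrder.Language.{0, 0}) (M : Type) [L.Structure M]

/-- `RankGE L M α w` says `rk(w, M) ≥ α`, for a (non-empty) finite subset `w` of the model `M`.
The tuple `a` runs over all enumerations `a₀, …, aₙ₋₁` of `w` without repetitions, and `φ` over
all quantifier free formulas in `n` variables.

* `rk(w) ≥ 0` iff whenever `M ⊨ φ[a₀, …, aₖ, …]`, the set of all `x` with `M ⊨ φ[a₀, …, x, …]`
  (`x` in place of `aₖ`) is uncountable;
* `rk(w) ≥ α + 1` iff whenever `M ⊨ φ[a₀, …, aₖ, …]`, there is an `x ∉ w` with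
  `rk(w ∪ {x}) ≥ α` and `M ⊨ φ[a₀, …, x, …]`;
* for limit `α`, `rk(w) ≥ α` iff `rk(w) ≥ β` for all `β < α`. -/
noncomputable def RankGE (α : Ordinal.{0}) : Finset M → Prop :=
  Ordinal.limitRecOn (motive := fun _ => Finset M → Prop) α
    (fun w => ∀ (n : ℕ) (a : Fin n → M), Function.Injective a → Set.range a = (w : Set M) →
      ∀ φ : L.Formula (Fin n), φ.IsQF → ∀ k : Fin n, φ.Realize a →
        ¬ {x : M | φ.Realize (Function.update a k x)}.Countable)
    (fun _ rankGE w => ∀ (n : ℕ) (a : Fin n → M), Function.Injective a →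
      Set.range a = (w : Set M) →
      ∀ φ : L.Formula (Fin n), φ.IsQF → ∀ k : Fin n, φ.Realize a →
        ∃ (x : M) (hx : x ∉ w), rankGE (Finset.cons x w hx) ∧
          φ.Realize (Function.update a k x))
    (fun α _ rankGE w => ∀ (β : Ordinal.{0}) (hβ : β < α), rankGE β hβ w)

open Classical in
/-- The rank `rk(w, M)`, whose value is `-1` (written `⊥`), an ordinal, or `∞` (written `⊤`).
It is `-1` if not `rk(w, M) ≥ 0`, it is `∞` if `rk(w, M) ≥ α` for all ordinals `α`, and otherwise
it is the ordinal `α` with `rk(w, M) ≥ α` but not `rk(w, M) ≥ α + 1`. -/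
noncomputable def modelRank (w : Finset M) : WithBot (WithTop Ordinal.{0}) :=
  if ¬ RankGE L M 0 w then ⊥
  else if ∀ α, RankGE L M α w then ((⊤ : WithTop Ordinal.{0}) : WithBot (WithTop Ordinal.{0}))
  else (((sInf {α : Ordinal.{0} | ¬ RankGE L M (α + 1) w} : Ordinal.{0}) : WithTop Ordinal.{0}) :
    WithBot (WithTop Ordinal.{0}))

end Rank

/-- `NPr_ε(lam)`: there is a model with universe `lam` and a countable vocabulary such that
`sup {rk(w) : w a non-empty finite subset of lam} < ε`. -/
def NPr (ε : Ordinal.{0}) (lam : Cardinal.{0}) : Prop :=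
  ∃ (L : FirstOrder.Language.{0, 0}) (_ : Countable L.Symbols) (_ : L.Structure lam.ord.ToType),
    (⨆ w : {w : Finset lam.ord.ToType // w.Nonempty}, modelRank L lam.ord.ToType w.1) <
      ((ε : WithTop Ordinal.{0}) : WithBot (WithTop Ordinal.{0}))

/-! ### Translations of subsets of the Cantor space -/

/-- The Cantor space of all infinite 0-1 sequences, with the product topology and coordinatewise
addition modulo 2. -/
abbrev CantorGroup : Type := ℕ → ZMod 2

/-- The translation `B + x`. -/
def translation (B : Set CantorGroup) (x : CantorGroup) : Set CantorGroup :=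
  (fun b => b + x) '' B

/-- `B` is a `k`-**pots**-set (perfectly orthogonal to `k`-small): for some perfect (that is,
non-empty, closed and without isolated points) set `P`, the translations `B + x`, `B + y` have at
least `k` points in common for all `x, y ∈ P`. -/
def IsPots (k : Cardinal.{0}) (B : Set CantorGroup) : Prop :=
  ∃ P : Set CantorGroup, Perfect P ∧ P.Nonempty ∧
    ∀ x ∈ P, ∀ y ∈ P, k ≤ #↥(translation B x ∩ translation B y)

/-- `B` is a `k`-**npots**-set if it is not a `k`-**pots**-set. -/
def IsNPots (k : Cardinal.{0}) (B : Set CantorGroup) : Prop :=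
  ¬ IsPots k B

/-- `B` has `lam` many pairwise `k`-nondisjoint translations: for some set `X` of cardinality
`lam`, `B + x` and `B + y` have at least `k` points in common for all `x, y ∈ X`. -/
def HasManyNondisjointTranslations (lam k : Cardinal.{0}) (B : Set CantorGroup) : Prop :=
  ∃ X : Set CantorGroup, #X = lam ∧
    ∀ x ∈ X, ∀ y ∈ X, k ≤ #↥(translation B x ∩ translation B y)

/-- `B` is `Σ⁰₂`: a countable union of closed sets. -/
def IsSigmaZeroTwo (B : Set CantorGroup) : Prop :=
  ∃ F : ℕ → Set CantorGroup, (∀ n, IsClosed (F n)) ∧ B = ⋃ n, F n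

/-! The set comes from a symmetric F_σ relation R on the Cantor space that has a clique of size
`lam` but no perfect clique. Fix a compact family, linearly independent over `ZMod 2`, of points x_t
and c_{i,s,t} with i < 2ι, and let B consist of all c_{i,s,t} and c_{i,s,t} + x_s + x_t with (s,t) ∈
R. For (s,t) ∈ R the translates B + x_s and B + x_t share the 2ι points c_{i,s,t} + x_s, so the
clique gives the many translations (`mk_le_mk_translation_inter`). Conversely, if x ≠ y and B + x, B
+ y share more than four points, then x + y = x_s + x_t for some (s,t) ∈ R (`exists_pair_of_lt_mk`).
A perfect set of such x lies in one translate of the family x_t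
(`LinearIndependent.exists_translation`), hence yields a perfect clique of R.

The relation comes from Martin's axiom. `NPr` gives a colouring of finite tuples by natural numbers
in which an ordinal attached to the colour drops when a tuple is extended by a point able to replace
its distinguished entry (`exists_isRankColouring`). With `lam` embedded in the Cantor space, a ccc
forcing adds a colouring of pairs such that pair colours and sufficiently long initial segments
determine the colour of a tuple; R is the union of the closures of the colour classes. In a perfect
clique, Baire category allows the distinguished entry of a tuple to be split into two nearby points
with the same pair colours towards the other entries. Reflected back to `lam`, this lowers the
ordinal, so a tuple of minimal ordinal gives a contradiction (`no_perfect_clique`). -/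

/-! ### From the rank to a colouring of finite tuples. -/

section RankColouring

variable {L : FirstOrder.Language.{0, 0}} {M : Type} [L.Structure M]

theorem rankGE_zero (w : Finset M) : RankGE L M 0 w ↔
    ∀ (n : ℕ) (a : Fin n → M), Function.Injective a → Set.range a = (w : Set M) →
      ∀ φ : L.Formula (Fin n), φ.IsQF → ∀ k : Fin n, φ.Realize a →
        ¬ {x : M | φ.Realize (Function.update a k x)}.Countable := by
  rw [RankGE, Ordinal.limitRecOn_zero]

theorem rankGE_add_one (α : Ordinal.{0}) (w : Finset M) : RankGE L M (α + 1) w ↔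
    ∀ (n : ℕ) (a : Fin n → M), Function.Injective a → Set.range a = (w : Set M) →
      ∀ φ : L.Formula (Fin n), φ.IsQF → ∀ k : Fin n, φ.Realize a →
        ∃ (x : M) (hx : x ∉ w), RankGE L M α (Finset.cons x w hx) ∧
          φ.Realize (Function.update a k x) := by
  rw [RankGE, Ordinal.limitRecOn_add_one]
  rfl

theorem rankGE_limit {α : Ordinal.{0}} (hα : Order.IsSuccLimit α) (w : Finset M) :
    RankGE L M α w ↔ ∀ β < α, RankGE L M β w := by
  rw [RankGE, Ordinal.limitRecOn_limit _ _ _ _ hα]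
  rfl

variable (L) in
/-- The least ordinal `α` such that `rk(w) ≥ α` fails. -/
noncomputable def rankBound (w : Finset M) : Ordinal.{0} := sInf {α | ¬ RankGE L M α w}

theorem rankGE_of_lt_rankBound {w : Finset M} {α : Ordinal.{0}} (h : α < rankBound L w) :
    RankGE L M α w := by
  by_contra h'
  exact absurd (csInf_le' h') (not_le.2 h)

theorem rankBound_le {w : Finset M} {α : Ordinal.{0}} (h : ¬ RankGE L M α w) :
    rankBound L w ≤ α :=
  csInf_le' h

theorem not_rankGE_rankBound {w : Finset M} {α : Ordinal.{0}} (h : ¬ RankGE L M α w) :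
    ¬ RankGE L M (rankBound L w) w :=
  csInf_mem (s := {α | ¬ RankGE L M α w}) ⟨α, h⟩

theorem exists_not_rankGE_of_modelRank_le {w : Finset M} {δ : Ordinal.{0}}
    (h : modelRank L M w ≤ ((δ : WithTop Ordinal.{0}) : WithBot (WithTop Ordinal.{0}))) :
    ∃ α ≤ δ + 1, ¬ RankGE L M α w := by
  unfold modelRank at h
  split_ifs at h with h0 h1
  · simp at h
  · rw [WithBot.coe_le_coe, WithTop.coe_le_coe] at h
    -- If all successor stages held, induction would give all stages, against `h1`; hence the
    -- infimum defining the rank is attained.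
    have hne : {α : Ordinal.{0} | ¬ RankGE L M (α + 1) w}.Nonempty := by
      by_contra hemp
      rw [Set.not_nonempty_iff_eq_empty, Set.eq_empty_iff_forall_notMem] at hemp
      simp only [Set.mem_ofPred_eq, not_not] at hemp
      refine h1 fun α => ?_
      induction α using WellFoundedLT.induction with
      | ind α ih =>
        rcases Ordinal.zero_or_succ_or_isSuccLimit α with rfl | ⟨β, rfl⟩ | hα
        · exact h0
        · exact hemp β
        · exact (rankGE_limit hα w).2 ih
    exact ⟨_, by gcongr, csInf_mem hne⟩
  · exact ⟨0, zero_le, h0⟩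

theorem exists_equiv_of_range_eq {ι κ α : Type*} {a : ι → α} {b : κ → α}
    (ha : Function.Injective a) (hb : Function.Injective b) (h : Set.range a = Set.range b) :
    ∃ g : ι ≃ κ, a = b ∘ g := by
  refine ⟨(Equiv.ofInjective a ha).trans ((Equiv.setCongr h).trans (Equiv.ofInjective b hb).symm),
    funext fun i => ?_⟩
  simp [Equiv.apply_ofInjective_symm]

open Classical in
/-- A witness to the value of the rank of the range of a tuple, given by a formula in the
variables of this tuple. -/
theorem exists_rank_witness {k : ℕ} (b : Fin k → M) (hb : Function.Injective b) {α : Ordinal.{0}}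
    (h : ¬ RankGE L M α (Finset.univ.image b)) :
    ∃ (φ : L.Formula (Fin k)) (i : Fin k), φ.Realize b ∧
      ((rankBound L (Finset.univ.image b) = 0 ∧
          {x : M | φ.Realize (Function.update b i x)}.Countable) ∨
        ∀ x (hx : x ∉ Finset.univ.image b), φ.Realize (Function.update b i x) →
          rankBound L (Finset.cons x _ hx) < rankBound L (Finset.univ.image b)) := by
  have h' := not_rankGE_rankBound h
  -- The rank speaks of arbitrary enumerations of the set; relabelling variables along the bijection
  -- moves a witness to the enumeration `b`.
  have key : ∀ (n : ℕ) (a : Fin n → M), Function.Injective a →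
      Set.range a = ((Finset.univ.image b : Finset M) : Set M) →
      ∀ (φ : L.Formula (Fin n)) (i : Fin n), φ.Realize a →
      ∃ (ψ : L.Formula (Fin k)) (j : Fin k), ψ.Realize b ∧
        ∀ x, ψ.Realize (Function.update b j x) ↔ φ.Realize (Function.update a i x) := by
    intro n a ha hab φ i hφ
    obtain ⟨g, rfl⟩ := exists_equiv_of_range_eq ha hb (by simpa using hab)
    refine ⟨φ.relabel g, g i, by simpa using hφ, fun x => ?_⟩
    rw [FirstOrder.Language.Formula.realize_relabel, Function.update_comp_equiv]
    simp
  rcases Ordinal.zero_or_succ_or_isSuccLimit (rankBound L (Finset.univ.image b)) with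
    h0 | ⟨β, hβ⟩ | hl
  · rw [h0, rankGE_zero] at h'
    push Not at h'
    obtain ⟨n, a, ha, hab, φ, -, i, hφ, hc⟩ := h'
    obtain ⟨ψ, j, hψ, hψφ⟩ := key n a ha hab φ i hφ
    exact ⟨ψ, j, hψ, Or.inl ⟨h0, by simpa only [hψφ] using hc⟩⟩
  · rw [← hβ] at h'
    replace h' := mt (rankGE_add_one β _).2 h'
    push Not at h'
    obtain ⟨n, a, ha, hab, φ, -, i, hφ, hc⟩ := h'
    obtain ⟨ψ, j, hψ, hψφ⟩ := key n a ha hab φ i hφ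
    refine ⟨ψ, j, hψ, Or.inr fun x hx hx' => ?_⟩
    rw [← hβ]
    refine (rankBound_le (α := β) fun hr => hc x hx hr ((hψφ x).1 hx')).trans_lt ?_
    exact Order.lt_succ β
  · exact absurd ((rankGE_limit hl _).2 fun β hβ => rankGE_of_lt_rankBound hβ) h'

/-- A colouring of finite tuples by natural numbers, with ordinals attached to colours, such that
the ordinal drops whenever a tuple is extended by a point which can replace the distinguished
entry of the tuple without a change of colour. -/
def IsRankColouring {M : Type} (c : ∀ k, (Fin (k + 1) → M) → ℕ) (pos : ∀ k, ℕ → Fin (k + 1))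
    (ρ : ℕ → ℕ → Ordinal.{0}) : Prop :=
  ∀ (k : ℕ) (b : Fin (k + 1) → M), Function.Injective b → ∀ a ∉ Set.range b,
    c k (Function.update b (pos k (c k b)) a) = c k b →
      ρ (k + 1) (c (k + 1) (Fin.snoc b a)) < ρ k (c k b)

-- The colour of a tuple codes its rank bound, a witnessing formula, the witnessing position, and
-- the index of the entry at this position in an enumeration of the witnessing set when that set is
-- countable. These are countably many data because `δ` is countable. The index excludes the
-- countable alternative of `exists_rank_witness`, so the ordinal must drop.
open Classical in
theorem exists_isRankColouring [Countable L.Symbols] {δ : Ordinal.{0}} (hδ : (Set.Iic δ).Countable)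
    (hr : ∀ w : Finset M, w.Nonempty → ∃ α ≤ δ, ¬ RankGE L M α w) :
    ∃ (c : ∀ k, (Fin (k + 1) → M) → ℕ) (pos : ∀ k, ℕ → Fin (k + 1)) (ρ : ℕ → ℕ → Ordinal.{0}),
      IsRankColouring c pos ρ := by
  have hC : Countable (Set.Iic δ) := hδ.to_subtype
  have wit : ∀ (k : ℕ) (b : Fin (k + 1) → M), ∃ (φ : L.Formula (Fin (k + 1))) (i : Fin (k + 1)),
      Function.Injective b → φ.Realize b ∧
      ((rankBound L (Finset.univ.image b) = 0 ∧
          {x : M | φ.Realize (Function.update b i x)}.Countable) ∨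
        ∀ x (hx : x ∉ Finset.univ.image b), φ.Realize (Function.update b i x) →
          rankBound L (Finset.cons x _ hx) < rankBound L (Finset.univ.image b)) := by
    intro k b
    by_cases hb : Function.Injective b
    · obtain ⟨α, -, hα⟩ := hr (Finset.univ.image b) (by simp)
      obtain ⟨φ, i, h⟩ := exists_rank_witness b hb hα
      exact ⟨φ, i, fun _ => h⟩
    · exact ⟨⊥, 0, fun h => absurd h hb⟩
  choose φ i hφ using wit
  have enum : ∀ S : Set M, ∃ f : M → ℕ, S.Countable → Set.InjOn f S := by
    intro S
    by_cases hS : S.Countable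
    · obtain ⟨f, hf⟩ := Set.countable_iff_exists_injOn.1 hS
      exact ⟨f, fun _ => hf⟩
    · exact ⟨fun _ => 0, fun h => absurd h hS⟩
  choose e he using enum
  have hmem : ∀ k (b : Fin (k + 1) → M), rankBound L (Finset.univ.image b) ∈ Set.Iic δ := by
    intro k b
    obtain ⟨α, h1, hα⟩ := hr (Finset.univ.image b) (by simp)
    exact (rankBound_le hα).trans h1
  let C : ℕ → Type 1 := fun k => Set.Iic δ × L.Formula (Fin (k + 1)) × Fin (k + 1) × ℕ
  have enc : ∀ k, ∃ f : C k → ℕ, Function.Injective f := fun k => exists_injective_nat _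
  choose f hf using enc
  have hne : ∀ k, Nonempty (C k) := fun k => ⟨⟨⟨0, by simp⟩, ⊥, 0, 0⟩⟩
  let c' : ∀ k, (Fin (k + 1) → M) → C k := fun k b =>
    ⟨⟨_, hmem k b⟩, φ k b, i k b, e {x | (φ k b).Realize (Function.update b (i k b) x)} (b (i k b))⟩
  have hinv : ∀ k b, Function.invFun (f k) (f k (c' k b)) = c' k b := fun k b =>
    Function.leftInverse_invFun (hf k) _
  refine ⟨fun k b => f k (c' k b), fun k m => (Function.invFun (f k) m).2.2.1,
    fun k m => ((Function.invFun (f k) m).1 : Ordinal), ?_⟩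
  intro k b hb a ha hcol
  simp only [hinv] at hcol ⊢
  replace hcol := hf k hcol
  set j := i k b with hj
  change c' k (Function.update b j a) = c' k b at hcol
  set b' := Function.update b j a with hb'
  have h2 : φ k b' = φ k b := congrArg (fun x : C k => x.2.1) hcol
  have h3 : i k b' = j := congrArg (fun x : C k => x.2.2.1) hcol
  have h4 : e {x | (φ k b').Realize (Function.update b' (i k b') x)} (b' (i k b')) =
      e {x | (φ k b).Realize (Function.update b j x)} (b j) :=
    congrArg (fun x : C k => x.2.2.2) hcol
  have hb'inj : Function.Injective b' := by
    intro x y hxy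
    by_contra hne
    have h1 : ∀ z, b z ≠ a := fun z hz => ha ⟨z, hz⟩
    rcases eq_or_ne x j with rfl | hx <;> rcases eq_or_ne y j with rfl | hy
    · exact hne rfl
    · simp [hb', hy] at hxy; exact h1 y hxy.symm
    · simp [hb', hx] at hxy; exact h1 x hxy
    · simp [hb', hx, hy] at hxy; exact hne (hb hxy)
  have hreal : (φ k b).Realize b' := h2 ▸ (hφ k b' hb'inj).1
  rw [h2, h3] at h4
  simp only [hb', Function.update_idem, Function.update_self] at h4
  rcases (hφ k b hb).2 with ⟨-, hcount⟩ | hdrop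
  -- `a` and `b j` have the same index in one countable set, hence coincide, although `a` is not an
  -- entry of `b`.
  · have := he _ hcount (by simpa using hreal) (by simpa [hj] using (hφ k b hb).1) h4
    exact absurd ⟨j, this.symm⟩ ha
  · have ha' : a ∉ Finset.univ.image b := by simpa using ha
    have := hdrop a ha' hreal
    simp only [c']
    convert this using 2
    ext x
    simp [Fin.exists_fin_succ', eq_comm, or_comm]

end RankColouring

theorem NPr.exists_isRankColouring {lam : Cardinal.{0}} [Nonempty lam.ord.ToType]
    (h : NPr ω₁ lam) :
    ∃ (c : ∀ k, (Fin (k + 1) → lam.ord.ToType) → ℕ) (pos : ∀ k, ℕ → Fin (k + 1))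
      (ρ : ℕ → ℕ → Ordinal.{0}), IsRankColouring c pos ρ := by
  obtain ⟨L, _, _, hL⟩ := h
  obtain ⟨δ, hδ, hle⟩ : ∃ δ < ω₁, ∀ w : Finset lam.ord.ToType, w.Nonempty →
      modelRank L _ w ≤ ((δ : WithTop Ordinal.{0}) : WithBot (WithTop Ordinal.{0})) := by
    have hw : ∀ w : Finset lam.ord.ToType, w.Nonempty → modelRank L _ w ≤
        ⨆ w : {w : Finset lam.ord.ToType // w.Nonempty}, modelRank L lam.ord.ToType w.1 :=
      fun w hw => le_iSup (fun w : {w : Finset lam.ord.ToType // w.Nonempty} =>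
        modelRank L lam.ord.ToType w.1) ⟨w, hw⟩
    revert hL hw
    generalize (⨆ w : {w : Finset lam.ord.ToType // w.Nonempty},
      modelRank L lam.ord.ToType w.1) = S
    intro hL hw
    induction S with
    | bot => exact ⟨0, Ordinal.omega_pos 1, fun w h => (hw w h).trans bot_le⟩
    | coe S =>
      induction S with
      | top => simp at hL
      | coe S => exact ⟨S, by simpa using hL, hw⟩
  refine _root_.exists_isRankColouring (L := L) (δ := δ + 1) ?_ fun w hw =>
    exists_not_rankGE_of_modelRank_le (hle w hw)
  have hlt : δ + 1 + 1 < ω₁ := by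
    have hl : Order.IsSuccLimit (ω₁ : Ordinal.{0}) := by
      rw [← Cardinal.ord_aleph]
      exact Cardinal.isSuccLimit_ord (Cardinal.aleph0_le_aleph 1)
    exact hl.succ_lt (hl.succ_lt hδ)
  rw [← Cardinal.le_aleph0_iff_set_countable]
  refine (Cardinal.mk_le_mk_of_subset (t := Set.Iio (δ + 1 + 1)) fun x hx =>
    lt_of_le_of_lt (Set.mem_Iic.1 hx) (Order.lt_succ (δ + 1))).trans ?_
  rw [Cardinal.mk_Iio_ordinal, Cardinal.lift_le_aleph0, ← Cardinal.lt_aleph_one_iff,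
    ← Cardinal.lt_ord, Cardinal.ord_aleph]
  exact hlt

/-! ### The forcing that adds a colouring of pairs. -/

section Forcing

/-- The sequences `x` and `y` have the same restriction to `n`. -/
def AgreeBelow (n : ℕ) (x y : ℕ → Bool) : Prop := ∀ i < n, x i = y i

theorem AgreeBelow.symm {n : ℕ} {x y : ℕ → Bool} (h : AgreeBelow n x y) : AgreeBelow n y x :=
  fun i hi => (h i hi).symm

theorem AgreeBelow.trans {n : ℕ} {x y z : ℕ → Bool} (h : AgreeBelow n x y)
    (h' : AgreeBelow n y z) : AgreeBelow n x z :=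
  fun i hi => (h i hi).trans (h' i hi)

theorem AgreeBelow.mono {m n : ℕ} {x y : ℕ → Bool} (h : AgreeBelow n x y) (hmn : m ≤ n) :
    AgreeBelow m x y :=
  fun i hi => h i (hi.trans_le hmn)

theorem AgreeBelow.refl (n : ℕ) (x : ℕ → Bool) : AgreeBelow n x x := fun _ _ => rfl

theorem exists_not_agreeBelow {x y : ℕ → Bool} (h : x ≠ y) : ∃ n, ¬ AgreeBelow n x y := by
  obtain ⟨i, hi⟩ := Function.ne_iff.1 h
  exact ⟨i + 1, fun h => hi (h i (Nat.lt_succ_self i))⟩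

/-- Finitely many distinct sequences are separated by their restrictions to some `n`. -/
theorem Finset.exists_agreeBelow_imp_eq {M : Type*} {s : M → ℕ → Bool}
    (hs : Function.Injective s) (w : Finset M) :
    ∃ n, ∀ α ∈ w, ∀ β ∈ w, AgreeBelow n (s α) (s β) → α = β := by
  classical
  have : ∀ p : M × M, ∃ n, AgreeBelow n (s p.1) (s p.2) → p.1 = p.2 := by
    intro p
    by_cases hp : p.1 = p.2
    · exact ⟨0, fun _ => hp⟩
    · obtain ⟨n, hn⟩ := exists_not_agreeBelow (hs.ne hp)
      exact ⟨n, fun h => absurd h hn⟩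
  choose f hf using this
  refine ⟨(w ×ˢ w).sup f, fun α hα β hβ h => hf (α, β) (h.mono ?_)⟩
  exact Finset.le_sup (f := f) (Finset.mk_mem_product hα hβ)

variable {M : Type} (s : M → ℕ → Bool) (c : ∀ k, (Fin (k + 1) → M) → ℕ)

/-- A finite approximation to a symmetric colouring of pairs of elements of `M`. -/
structure PairCondition (s : M → ℕ → Bool) (c : ∀ k, (Fin (k + 1) → M) → ℕ) where
  dom : Finset M
  height : ℕ
  bound : ℕ
  colour : M → M → ℕ
  colour_symm : ∀ α β, colour α β = colour β α
  colour_lt : ∀ α ∈ dom, ∀ β ∈ dom, colour α β < bound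
  eq_of_agree : ∀ α ∈ dom, ∀ β ∈ dom, AgreeBelow height (s α) (s β) → α = β

namespace PairCondition

variable {s c}

/-- The tuple `b` of elements of the domain of `p` is a copy of the tuple `a` coloured by `h`. -/
structure IsCopy (p : PairCondition s c) (h : M → M → ℕ) {k : ℕ} (b a : Fin (k + 1) → M) :
    Prop where
  mem : ∀ i, b i ∈ p.dom
  agree : ∀ i, AgreeBelow p.height (s (b i)) (s (a i))
  colour_eq : ∀ i j, i ≠ j → p.colour (b i) (b j) = h (a i) (a j)
  tuple_eq : c k b = c k a

/-- The order on conditions: stronger conditions do not create new types of tuples all whose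
pairs have old colours. -/
structure Extends (p q : PairCondition s c) : Prop where
  dom : p.dom ⊆ q.dom
  height : p.height ≤ q.height
  bound : p.bound ≤ q.bound
  colour : ∀ α ∈ p.dom, ∀ β ∈ p.dom, p.colour α β = q.colour α β
  exists_copy : ∀ (k : ℕ) (a : Fin (k + 1) → M), 1 ≤ k → (∀ i, a i ∈ q.dom) →
    (∀ i j, i ≠ j → q.colour (a i) (a j) < p.bound) →
    (∀ i j, i ≠ j → ¬ AgreeBelow p.height (s (a i)) (s (a j))) →
    ∃ b, p.IsCopy q.colour b a

theorem Extends.refl (p : PairCondition s c) : Extends p p where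
  dom := subset_rfl
  height := le_rfl
  bound := le_rfl
  colour _ _ _ _ := rfl
  exists_copy _ a _ ha _ _ := ⟨a, ha, fun _ => AgreeBelow.refl _ _, fun _ _ _ => rfl, rfl⟩

theorem Extends.trans {p q r : PairCondition s c} (hpq : Extends p q) (hqr : Extends q r) :
    Extends p r where
  dom := hpq.dom.trans hqr.dom
  height := hpq.height.trans hqr.height
  bound := hpq.bound.trans hqr.bound
  colour α hα β hβ :=
    (hpq.colour α hα β hβ).trans (hqr.colour α (hpq.dom hα) β (hpq.dom hβ))
  exists_copy k a hk ha hcol hsep := by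
    obtain ⟨b, hb⟩ := hqr.exists_copy k a hk ha (fun i j hij => (hcol i j hij).trans_le hpq.bound)
      fun i j hij h => hsep i j hij (h.mono hpq.height)
    obtain ⟨d, hd⟩ := hpq.exists_copy k b hk hb.mem
      (fun i j hij => by rw [hb.colour_eq i j hij]; exact hcol i j hij)
      fun i j hij h => hsep i j hij
        ((((hb.agree i).mono hpq.height).symm.trans h).trans ((hb.agree j).mono hpq.height))
    exact ⟨d, hd.mem, fun i => (hd.agree i).trans ((hb.agree i).mono hpq.height),
      fun i j hij => (hd.colour_eq i j hij).trans (hb.colour_eq i j hij),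
      hd.tuple_eq.trans hb.tuple_eq⟩

instance : Preorder (PairCondition s c) where
  le := Extends
  le_refl := Extends.refl
  le_trans _ _ _ := Extends.trans

open Classical in
/-- Extending a condition to a larger domain, height and bound on colours. -/
noncomputable def enlarge (p : PairCondition s c) (w : Finset M) (n : ℕ) (m : ℕ)
    (hn : ∀ α ∈ p.dom ∪ w, ∀ β ∈ p.dom ∪ w, AgreeBelow n (s α) (s β) → α = β) :
    PairCondition s c where
  dom := p.dom ∪ w
  height := max n p.height
  bound := max m (p.bound + 1)
  colour α β := if α ∈ p.dom ∧ β ∈ p.dom then p.colour α β else p.bound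
  colour_symm α β := by simp only [and_comm, p.colour_symm α β]
  colour_lt α _ β _ := by
    split_ifs with h
    · have := p.colour_lt α h.1 β h.2
      omega
    · omega
  eq_of_agree α hα β hβ h := hn α hα β hβ (h.mono (le_max_left _ _))

theorem le_enlarge (p : PairCondition s c) (w : Finset M) (n : ℕ) (m : ℕ) (hn) :
    p ≤ p.enlarge w n m hn := by
  classical
  refine ⟨?_, le_max_right _ _, ?_, ?_, ?_⟩
  · intro α hα
    simp [enlarge, hα]
  · simp only [enlarge]; omega
  · intro α hα β hβ
    simp [enlarge, hα, hβ]
  · intro k a hk _ hcol _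
    have hmem : ∀ i, a i ∈ p.dom := by
      intro i
      -- Every new pair has the fresh colour `p.bound`, so an entry outside `p.dom` is betrayed by
      -- any second entry. A one-point tuple has no pairs, which is why `Extends` asks for `1 ≤ k`.
      have : Nontrivial (Fin (k + 1)) := Fin.nontrivial_iff_two_le.2 (by omega)
      obtain ⟨j, hj⟩ := exists_ne i
      by_contra hi
      have := hcol i j hj.symm
      simp [enlarge, hi] at this
    refine ⟨a, hmem, fun _ => AgreeBelow.refl _ _, fun i j _ => ?_, rfl⟩
    simp [enlarge, hmem]

theorem isCofinal_enlarge (hs : Function.Injective s) (w : Finset M) (N : ℕ) :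
    IsCofinal {p : PairCondition s c | w ⊆ p.dom ∧ N ≤ p.height ∧ N ≤ p.bound} := by
  classical
  intro p
  obtain ⟨n, hn⟩ := (p.dom ∪ w).exists_agreeBelow_imp_eq hs
  refine ⟨p.enlarge w (max n N) N fun α hα β hβ h => hn α hα β hβ (h.mono (le_max_left _ _)),
    ⟨?_, ?_, ?_⟩, le_enlarge _ _ _ _ _⟩
  · intro α hα
    simp [enlarge, hα]
  · simp [enlarge]
  · simp [enlarge]

/-- The conditions `p` and `q` have the same shape: there is a correspondence between their
domains which preserves everything. -/
structure SameShape (p q : PairCondition s c) : Prop where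
  height : p.height = q.height
  bound : p.bound = q.bound
  exists_copy : ∀ k (a : Fin (k + 1) → M), (∀ i, a i ∈ q.dom) →
    (∀ i j, i ≠ j → ¬ AgreeBelow p.height (s (a i)) (s (a j))) → ∃ b, p.IsCopy q.colour b a
  colour_eq : ∀ α ∈ p.dom, α ∈ q.dom → ∀ β ∈ p.dom, β ∈ q.dom → p.colour α β = q.colour α β

/-- Cross pairs have new colours, so a tuple with only old colours lies within one of the two
domains. In `p.dom` it is its own copy; in `q.dom` the common shape supplies a copy. -/
theorem SameShape.le_of_amalgam {p q r : PairCondition s c} (h : SameShape p q)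
    (hdom : ∀ α, α ∈ r.dom ↔ α ∈ p.dom ∨ α ∈ q.dom) (hheight : p.height ≤ r.height)
    (hbound : p.bound ≤ r.bound)
    (hp : ∀ α ∈ p.dom, ∀ β ∈ p.dom, p.colour α β = r.colour α β)
    (hq : ∀ α ∈ q.dom, ∀ β ∈ q.dom, q.colour α β = r.colour α β)
    (hpq : ∀ α ∈ p.dom, α ∉ q.dom → ∀ β ∈ q.dom, β ∉ p.dom → p.bound ≤ r.colour α β) :
    p ≤ r := by
  refine ⟨fun α hα => (hdom α).2 (Or.inl hα), hheight, hbound, hp, ?_⟩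
  intro k a hk ha hcol hsep
  by_cases hap : ∀ i, a i ∈ p.dom
  · exact ⟨a, hap, fun _ => AgreeBelow.refl _ _, fun i j _ => hp _ (hap i) _ (hap j), rfl⟩
  push Not at hap
  obtain ⟨j, hj⟩ := hap
  have hjq : a j ∈ q.dom := ((hdom _).1 (ha j)).resolve_left hj
  have haq : ∀ i, a i ∈ q.dom := by
    intro i
    by_contra hi
    have hip : a i ∈ p.dom := ((hdom _).1 (ha i)).resolve_right hi
    have hij : i ≠ j := by rintro rfl; exact hi hjq
    exact absurd (hcol i j hij) (not_lt.2 (hpq _ hip hi _ hjq hj))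
  obtain ⟨b, hb⟩ := h.exists_copy k a haq hsep
  exact ⟨b, hb.mem, hb.agree, fun i j hij => (hb.colour_eq i j hij).trans
    (hq _ (haq i) _ (haq j)), hb.tuple_eq⟩

theorem SameShape.compatible (hs : Function.Injective s) {p q : PairCondition s c}
    (h : SameShape p q) (h' : SameShape q p) : ForcingCompatible p q := by
  classical
  obtain ⟨n, hn⟩ := (p.dom ∪ q.dom).exists_agreeBelow_imp_eq hs
  have hheight := h.height
  have hbound := h.bound
  let r : PairCondition s c :=
    { dom := p.dom ∪ q.dom
      height := max n p.height
      bound := p.bound + 1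
      colour := fun α β => if α ∈ p.dom ∧ β ∈ p.dom then p.colour α β else
        if α ∈ q.dom ∧ β ∈ q.dom then q.colour α β else p.bound
      colour_symm := fun α β => by
        simp only [and_comm, p.colour_symm α β, q.colour_symm α β]
      colour_lt := fun α _ β _ => by
        split_ifs with h1 h2
        · have := p.colour_lt α h1.1 β h1.2
          omega
        · have := q.colour_lt α h2.1 β h2.2
          omega
        · omega
      eq_of_agree := fun α hα β hβ h => hn α hα β hβ (h.mono (le_max_left _ _)) }
  have hp : ∀ α ∈ p.dom, ∀ β ∈ p.dom, p.colour α β = r.colour α β := by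
    intro α hα β hβ
    simp [r, hα, hβ]
  have hq : ∀ α ∈ q.dom, ∀ β ∈ q.dom, q.colour α β = r.colour α β := by
    intro α hα β hβ
    by_cases hpp : α ∈ p.dom ∧ β ∈ p.dom
    · rw [← hp α hpp.1 β hpp.2, h.colour_eq α hpp.1 hα β hpp.2 hβ]
    · simp [r, hα, hβ, hpp]
  refine ⟨r, h.le_of_amalgam (by simp [r]) (by simp [r]) (by simp [r]) hp hq ?_,
    h'.le_of_amalgam (by simp [r, or_comm]) (by simp [r, hheight]) (by simp [r, hbound]) hq hp ?_⟩
  · intro α hα hα' β hβ hβ'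
    simp [r, hα', hβ']
  · intro α hα hα' β hβ hβ'
    simp [r, hα', hβ', hbound]

/-- The restriction of `x` to `n`. -/
def restrictBelow (n : ℕ) (x : ℕ → Bool) : Fin n → Bool := fun i => x i

theorem restrictBelow_eq_iff {n : ℕ} {x y : ℕ → Bool} :
    restrictBelow n x = restrictBelow n y ↔ AgreeBelow n x y :=
  ⟨fun h i hi => congrFun h ⟨i, hi⟩, fun h => funext fun i => h i i.2⟩

/-- The element of the domain with a given restriction. -/
noncomputable def lift [Nonempty M] (p : PairCondition s c) (n : ℕ) : (Fin n → Bool) → M :=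
  Function.invFunOn (fun α => restrictBelow n (s α)) (p.dom : Set M)

theorem lift_restrict [Nonempty M] (p : PairCondition s c) {n : ℕ} (hn : p.height = n) {α : M}
    (hα : α ∈ p.dom) : p.lift n (restrictBelow n (s α)) = α := by
  subst hn
  refine Set.InjOn.leftInvOn_invFunOn (f := fun α => restrictBelow p.height (s α)) ?_ hα
  intro x hx y hy hxy
  exact p.eq_of_agree x hx y hy (restrictBelow_eq_iff.1 hxy)

theorem lift_spec [Nonempty M] (p : PairCondition s c) {n : ℕ} {σ : Fin n → Bool}
    (h : ∃ α ∈ p.dom, restrictBelow n (s α) = σ) :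
    p.lift n σ ∈ p.dom ∧ restrictBelow n (s (p.lift n σ)) = σ :=
  ⟨Function.invFunOn_mem (s := (p.dom : Set M)) h, Function.invFunOn_eq (s := (p.dom : Set M)) h⟩

/-- Shapes of conditions of height `n`. -/
abbrev Shape (n : ℕ) : Type :=
  ℕ × Set (Fin n → Bool) × ((Fin n → Bool) → (Fin n → Bool) → ℕ) ×
    ∀ k : Fin (2 ^ n), (Fin (k + 1) → Fin n → Bool) → ℕ

/-- The shape of a condition. -/
noncomputable def shape [Nonempty M] (n : ℕ) (p : PairCondition s c) : Shape n :=
  ⟨p.bound, (fun α => restrictBelow n (s α)) '' p.dom,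
    fun σ τ => p.colour (p.lift n σ) (p.lift n τ), fun k v => c k fun i => p.lift n (v i)⟩

theorem sameShape_of_shape_eq [Nonempty M] {n : ℕ} {p q : PairCondition s c}
    (hp : p.height = n) (hq : q.height = n) (h : p.shape n = q.shape n) : SameShape p q := by
  have h1 : p.bound = q.bound := congrArg (fun x : Shape n => x.1) h
  have h2 : (fun α => restrictBelow n (s α)) '' p.dom = (fun α => restrictBelow n (s α)) '' q.dom :=
    congrArg (fun x : Shape n => x.2.1) h
  have h3 : ∀ σ τ, p.colour (p.lift n σ) (p.lift n τ) = q.colour (q.lift n σ) (q.lift n τ) :=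
    fun σ τ => congrFun (congrFun (congrArg (fun x : Shape n => x.2.2.1) h) σ) τ
  have h4 : ∀ (k : Fin (2 ^ n)) (v : Fin (k + 1) → Fin n → Bool),
      c k (fun i => p.lift n (v i)) = c k fun i => q.lift n (v i) :=
    fun k v => congrFun (congrFun (congrArg (fun x : Shape n => x.2.2.2) h) k) v
  refine ⟨hp.trans hq.symm, h1, ?_, ?_⟩
  · intro k a ha hsep
    set v : Fin (k + 1) → Fin n → Bool := fun i => restrictBelow n (s (a i)) with hv
    -- The entries have distinct restrictions to `n`, so `Shape n` need record only tuples of length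
    -- at most `2 ^ n`; this keeps the type of shapes countable.
    have hk : k < 2 ^ n := by
      have hinj : Function.Injective v := by
        intro i j hij
        by_contra hne
        exact hsep i j hne (hp ▸ restrictBelow_eq_iff.1 hij)
      have := Fintype.card_le_of_injective v hinj
      simp only [Fintype.card_fin, Fintype.card_pi, Fintype.card_bool, Finset.prod_const,
        Finset.card_univ] at this
      omega
    have hlift : ∀ i, q.lift n (v i) = a i := fun i => q.lift_restrict hq (ha i)
    have hspec : ∀ i, p.lift n (v i) ∈ p.dom ∧ restrictBelow n (s (p.lift n (v i))) = v i := by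
      intro i
      have : v i ∈ (fun α => restrictBelow n (s α)) '' p.dom := h2 ▸ ⟨a i, ha i, rfl⟩
      exact p.lift_spec this
    refine ⟨fun i => p.lift n (v i), fun i => (hspec i).1, fun i => ?_, fun i j _ => ?_, ?_⟩
    · rw [hp]
      exact restrictBelow_eq_iff.1 (hspec i).2
    · rw [h3, hlift, hlift]
    · have := h4 ⟨k, hk⟩ v
      simpa only [hlift] using this
  · intro α hα hα' β hβ hβ'
    have := h3 (restrictBelow n (s α)) (restrictBelow n (s β))
    rwa [p.lift_restrict hp hα, p.lift_restrict hp hβ, q.lift_restrict hq hα',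
      q.lift_restrict hq hβ'] at this

/-- Conditions of the same height and shape are compatible, and each height has only countably many
shapes. -/
theorem forcingCCC [Nonempty M] (hs : Function.Injective s) : ForcingCCC (PairCondition s c) := by
  intro A hA
  have : A = ⋃ n : ℕ, {p ∈ A | p.height = n} := by
    ext p
    simp
  rw [this]
  refine Set.countable_iUnion fun n => ?_
  refine Set.countable_of_injective_of_countable_image (f := shape n) ?_ (Set.to_countable _)
  intro p hp q hq hpq
  by_contra hne
  exact hA hp.1 hq.1 hne ((sameShape_of_shape_eq hp.2 hq.2 hpq).compatible hs
    (sameShape_of_shape_eq hq.2 hp.2 hpq.symm))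

instance : Nonempty (PairCondition s c) :=
  ⟨{ dom := ∅, height := 0, bound := 0, colour := fun _ _ => 0, colour_symm := fun _ _ => rfl,
     colour_lt := by simp, eq_of_agree := by simp }⟩

end PairCondition

open PairCondition in
theorem MartinsAxiom.exists_generic (hMA : MartinsAxiom) [Nonempty M] (hM : #M < 𝔠)
    (hs : Function.Injective s) :
    ∃ G : Order.Ideal (PairCondition s c), (∀ α, ∃ p ∈ G, α ∈ p.dom) ∧
      ∀ N, ∃ p ∈ G, N ≤ p.height ∧ N ≤ p.bound := by
  set 𝒟 : Set (Set (PairCondition s c)) := Set.range fun x : M × ℕ =>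
    {p : PairCondition s c | {x.1} ⊆ p.dom ∧ x.2 ≤ p.height ∧ x.2 ≤ p.bound} with h𝒟
  have hcard : #𝒟 < 𝔠 := by
    refine Cardinal.mk_range_le.trans_lt ?_
    rw [Cardinal.mk_prod, Cardinal.lift_id, Cardinal.lift_id, Cardinal.mk_nat]
    exact Cardinal.mul_lt_of_lt Cardinal.aleph0_le_continuum hM Cardinal.aleph0_lt_continuum
  have hdense : ∀ D ∈ 𝒟, IsCofinal D := by
    rintro _ ⟨x, rfl⟩
    exact isCofinal_enlarge hs _ _
  obtain ⟨G, hG⟩ := hMA (PairCondition s c) (forcingCCC hs) 𝒟 hcard hdense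
  have : ∀ (α : M) (N : ℕ), ∃ p ∈ G, α ∈ p.dom ∧ N ≤ p.height ∧ N ≤ p.bound := by
    intro α N
    obtain ⟨p, hp, hpG⟩ := hG _ ⟨(α, N), rfl⟩
    exact ⟨p, hpG, by simpa using hp⟩
  refine ⟨G, fun α => ?_, fun N => ?_⟩
  · obtain ⟨p, hp, h, -⟩ := this α 0
    exact ⟨p, hp, h⟩
  · obtain ⟨p, hp, -, h⟩ := this (Classical.arbitrary M) N
    exact ⟨p, hp, h⟩

end Forcing

/-! ### Baire category: generic tuples in a perfect compact space. -/

section GenericTuples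

open Topology

variable {Q : Type*} [TopologicalSpace Q]

/-- A tuple of distinct points of `Y` each pair of which lies in the interior of the indicated
member of the family `F`. -/
structure IsGenericTuple (F : ℕ → Set (Q × Q)) (Y : Set Q) {k : ℕ} (y : Fin (k + 1) → Q)
    (m : Fin (k + 1) → Fin (k + 1) → ℕ) : Prop where
  injective : Function.Injective y
  mem : ∀ i, y i ∈ Y
  pair_mem : ∀ i j, i ≠ j → (y i, y j) ∈ interior (F (m i j))

theorem interior_diagonal_eq_empty [hQ : ∀ x : Q, (𝓝[≠] x).NeBot] : interior (Set.diagonal Q) = ∅ := by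
  rw [Set.eq_empty_iff_forall_notMem]
  rintro ⟨x, x'⟩ hx
  obtain rfl : x = x' := interior_subset (s := Set.diagonal Q) hx
  rw [mem_interior_iff_mem_nhds, nhds_prod_eq, Filter.mem_prod_iff] at hx
  obtain ⟨u, hu, v, hv, huv⟩ := hx
  obtain ⟨z, hzv, hz⟩ := ((mem_nhdsWithin_of_mem_nhds hv :
    v ∈ 𝓝[≠] x) |> fun h => Filter.nonempty_of_mem (Filter.inter_mem h self_mem_nhdsWithin))
  exact hz (huv (Set.mk_mem_prod (mem_of_mem_nhds hu) hzv) : x = z).symm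

/-- The closed sets `F m` together with the diagonal cover the square, so by Baire category their
interiors have dense union; the diagonal contributes nothing, as there are no isolated points. -/
theorem dense_iUnion_interior_of_forall_ne [CompactSpace Q] [T2Space Q]
    [hQ : ∀ x : Q, (𝓝[≠] x).NeBot] {F : ℕ → Set (Q × Q)} (hF : ∀ m, IsClosed (F m))
    (hcover : ∀ p q, p ≠ q → ∃ m, (p, q) ∈ F m) : Dense (⋃ m, interior (F m)) := by
  have := dense_iUnion_interior_of_closed
    (f := fun o : Option ℕ => o.elim (Set.diagonal Q) F) ?_ ?_
  · refine this.mono (Set.iUnion_subset ?_)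
    rintro (_ | m)
    · simp [interior_diagonal_eq_empty]
    · exact Set.subset_iUnion (fun m => interior (F m)) m
  · rintro (_ | m)
    · exact isClosed_diagonal
    · exact hF m
  · rw [Set.eq_univ_iff_forall]
    rintro ⟨p, q⟩
    by_cases h : p = q
    · exact Set.mem_iUnion.2 ⟨none, h⟩
    · obtain ⟨m, hm⟩ := hcover p q h
      exact Set.mem_iUnion.2 ⟨some m, hm⟩

/-- The easy half of the Kuratowski-Ulam theorem, for open dense sets. -/
theorem exists_dense_forall_dense_section [CompactSpace Q] [T2Space Q]
    [SecondCountableTopology Q] {U : Set (Q × Q)}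
    (hUo : IsOpen U) (hU : Dense U) :
    ∃ Y : Set Q, Dense Y ∧ ∀ y ∈ Y, Dense {y' | (y', y) ∈ U} := by
  set B := TopologicalSpace.countableBasis Q with hB
  have hBb : TopologicalSpace.IsTopologicalBasis B := TopologicalSpace.isBasis_countableBasis Q
  have hBc : B.Countable := TopologicalSpace.countable_countableBasis Q
  have hBn : ∀ o ∈ B, o.Nonempty := fun o ho =>
    TopologicalSpace.nonempty_of_mem_countableBasis ho
  -- `E o` is the open dense set of points whose section of `U` meets the basic open set `o`.
  let E : Set Q → Set Q := fun o => Prod.snd '' (U ∩ o ×ˢ Set.univ)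
  refine ⟨⋂ o ∈ B, E o, dense_biInter_of_isOpen ?_ hBc ?_, ?_⟩
  · intro o ho
    exact isOpenMap_snd _ (hUo.inter ((hBb.isOpen ho).prod isOpen_univ))
  · intro o ho
    rw [dense_iff_inter_open]
    intro V hV hVn
    obtain ⟨⟨a, b⟩, ⟨ha, hb⟩, hab⟩ := hU.inter_open_nonempty (o ×ˢ V) ((hBb.isOpen ho).prod hV)
      ((hBn o ho).prod hVn)
    exact ⟨b, hb, (a, b), ⟨hab, ha, trivial⟩, rfl⟩
  · intro y hy
    rw [dense_iff_inter_open]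
    rintro V hV ⟨z, hz⟩
    obtain ⟨o, ho, -, hoV⟩ := hBb.exists_subset_of_mem_open hz hV
    obtain ⟨⟨a, b⟩, ⟨hab, ha, -⟩, rfl⟩ := Set.mem_iInter₂.1 hy o ho
    exact ⟨a, hoV ha, hab⟩

/-- Interiors are open, so any point close to `y i₀` has the same colours towards the other entries.
As `y i₀ ∈ Y`, such a point can moreover be chosen to form with `y i₀` a pair in some interior; this
section is open, so density of `Y` puts the new point in `Y`. -/
theorem IsGenericTuple.exists_snoc [T2Space Q] [hQ : ∀ x : Q, (𝓝[≠] x).NeBot]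
    {F : ℕ → Set (Q × Q)}
    (hsymm : ∀ m p q, (p, q) ∈ F m → (q, p) ∈ F m) {Y : Set Q} (hY : Dense Y)
    (hsec : ∀ y ∈ Y, Dense {y' | (y', y) ∈ ⋃ m, interior (F m)}) {k : ℕ} {y : Fin (k + 1) → Q}
    {m : Fin (k + 1) → Fin (k + 1) → ℕ} (h : IsGenericTuple F Y y m) (i₀ : Fin (k + 1))
    {V : Set Q} (hV : V ∈ 𝓝 (y i₀)) :
    ∃ y' ∈ V, ∃ m' : Fin (k + 2) → Fin (k + 2) → ℕ,
      IsGenericTuple F Y (Fin.snoc y y' : Fin (k + 2) → Q) m' ∧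
      (∀ i j, m' i.castSucc j.castSucc = m i j) ∧
      (∀ j, j ≠ i₀ → m' (Fin.last _) j.castSucc = m i₀ j ∧ m' j.castSucc (Fin.last _) = m j i₀) := by
  have hswap : ∀ n p q, (p, q) ∈ interior (F n) → (q, p) ∈ interior (F n) := by
    intro n p q hpq
    have : Prod.swap ⁻¹' interior (F n) ⊆ interior (F n) := by
      refine interior_maximal ?_ (isOpen_interior.preimage continuous_swap)
      rintro ⟨a, b⟩ hab
      exact hsymm n b a (interior_subset hab)
    exact this hpq
  have hev : ∀ᶠ y' in 𝓝 (y i₀), ∀ j, j ≠ i₀ → y' ≠ y j ∧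
      (y', y j) ∈ interior (F (m i₀ j)) ∧ (y j, y') ∈ interior (F (m j i₀)) := by
    rw [Filter.eventually_all]
    intro j
    by_cases hj : j = i₀
    · simp [hj]
    have h1 : ∀ᶠ y' in 𝓝 (y i₀), y' ≠ y j := isOpen_ne.mem_nhds (h.injective.ne (Ne.symm hj))
    have h2 : ∀ᶠ y' in 𝓝 (y i₀), (y', y j) ∈ interior (F (m i₀ j)) :=
      (by fun_prop : Continuous fun y' : Q => (y', y j)).continuousAt.preimage_mem_nhds
        (isOpen_interior.mem_nhds (h.pair_mem i₀ j (Ne.symm hj)))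
    have h3 : ∀ᶠ y' in 𝓝 (y i₀), (y j, y') ∈ interior (F (m j i₀)) :=
      (by fun_prop : Continuous fun y' : Q => (y j, y')).continuousAt.preimage_mem_nhds
        (isOpen_interior.mem_nhds (h.pair_mem j i₀ hj))
    filter_upwards [h1, h2, h3] with y' a b c _
    exact ⟨a, b, c⟩
  obtain ⟨W, hW, hWo, hyW⟩ := mem_nhds_iff.1 (Filter.inter_mem hV hev)
  set D : Set Q := {y' | (y', y i₀) ∈ ⋃ m, interior (F m)} with hD
  have hDo : IsOpen D :=
    (isOpen_iUnion fun m => isOpen_interior).preimage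
      (by fun_prop : Continuous fun y' : Q => (y', y i₀))
  have hWn : (W ∩ {y i₀}ᶜ).Nonempty := by
    have := Filter.nonempty_of_mem (f := 𝓝[≠] (y i₀))
      (Filter.inter_mem (mem_nhdsWithin_of_mem_nhds (hWo.mem_nhds hyW)) self_mem_nhdsWithin)
    exact this
  have hWDn : ((W ∩ {y i₀}ᶜ) ∩ D).Nonempty :=
    (hsec _ (h.mem i₀)).inter_open_nonempty _ (hWo.inter isOpen_compl_singleton) hWn
  obtain ⟨y', ⟨⟨hy'W, hy'ne⟩, hy'D⟩, hy'Y⟩ :=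
    hY.inter_open_nonempty _ ((hWo.inter isOpen_compl_singleton).inter hDo) hWDn
  obtain ⟨m₀, hm₀⟩ := Set.mem_iUnion.1 hy'D
  obtain ⟨hy'V, hy'⟩ := hW hy'W
  have hne : ∀ j, y' ≠ y j := by
    intro j
    by_cases hj : j = i₀
    · exact hj ▸ hy'ne
    · exact (hy' j hj).1
  refine ⟨y', hy'V, fun i j => Fin.lastCases
    (Fin.lastCases 0 (fun j => if j = i₀ then m₀ else m i₀ j) j)
    (fun i => Fin.lastCases (if i = i₀ then m₀ else m i i₀) (fun j => m i j) j) i,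
    ⟨?_, ?_, ?_⟩, ?_, ?_⟩
  · rw [Fin.snoc_injective_iff]
    exact ⟨h.injective, fun ⟨j, hj⟩ => hne j hj.symm⟩
  · intro i
    induction i using Fin.lastCases with
    | last => simpa using hy'Y
    | cast i => simpa using h.mem i
  · intro i j hij
    induction i using Fin.lastCases with
    | last =>
      induction j using Fin.lastCases with
      | last => exact absurd rfl hij
      | cast j =>
        by_cases hj : j = i₀
        · subst hj; simpa using hm₀
        · simpa [hj] using (hy' j hj).2.1
    | cast i =>
      induction j using Fin.lastCases with
      | last =>
        by_cases hi : i = i₀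
        · subst hi; simpa using hswap _ _ _ hm₀
        · simpa [hi] using (hy' i hi).2.2
      | cast j => simpa using h.pair_mem i j (by simpa using hij)
  · intro i j
    simp
  · intro j hj
    simp [hj]

end GenericTuples

/-! ### The generic relation has no perfect clique. -/

section Clique

open Topology

variable {M : Type} {s : M → ℕ → Bool} {c : ∀ k, (Fin (k + 1) → M) → ℕ}

/-- The symmetric colouring of pairs determined by a generic filter. -/
theorem exists_generic_colouring {G : Order.Ideal (PairCondition s c)}
    (hG : ∀ α, ∃ p ∈ G, α ∈ p.dom) :
    ∃ h : M → M → ℕ, (∀ α β, h α β = h β α) ∧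
      ∀ p ∈ G, ∀ α ∈ p.dom, ∀ β ∈ p.dom, h α β = p.colour α β := by
  have hex : ∀ α β, ∃ p ∈ G, α ∈ p.dom ∧ β ∈ p.dom := by
    intro α β
    obtain ⟨p, hp, hα⟩ := hG α
    obtain ⟨q, hq, hβ⟩ := hG β
    obtain ⟨r, hr, hpr, hqr⟩ := G.directed p hp q hq
    exact ⟨r, hr, hpr.dom hα, hqr.dom hβ⟩
  choose P hP hα hβ using hex
  have key : ∀ p ∈ G, ∀ α ∈ p.dom, ∀ β ∈ p.dom, (P α β).colour α β = p.colour α β := by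
    intro p hp α h1 β h2
    obtain ⟨r, hr, hpr, hqr⟩ := G.directed p hp _ (hP α β)
    rw [hpr.colour α h1 β h2, hqr.colour α (hα α β) β (hβ α β)]
  refine ⟨fun α β => (P α β).colour α β, fun α β => ?_, key⟩
  beta_reduce
  rw [key _ (hP β α) α (hβ β α) β (hα β α), PairCondition.colour_symm]

variable (s) in
/-- The closure of the set of pairs of colour `m`. -/
def colourClosure (h : M → M → ℕ) (m : ℕ) : Set ((ℕ → Bool) × (ℕ → Bool)) :=
  closure {z | ∃ α β, h α β = m ∧ z = (s α, s β)}

theorem isClosed_colourClosure (h : M → M → ℕ) (m : ℕ) : IsClosed (colourClosure s h m) :=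
  isClosed_closure

theorem mem_colourClosure (h : M → M → ℕ) (α β : M) :
    (s α, s β) ∈ colourClosure s h (h α β) :=
  subset_closure ⟨α, β, rfl, rfl⟩

theorem colourClosure_symm {h : M → M → ℕ} (hh : ∀ α β, h α β = h β α) {m : ℕ}
    {x y : ℕ → Bool} (hxy : (x, y) ∈ colourClosure s h m) : (y, x) ∈ colourClosure s h m := by
  have := map_mem_closure continuous_swap hxy (t := {z | ∃ α β, h α β = m ∧ z = (s α, s β)}) ?_
  · exact this
  · rintro _ ⟨α, β, hm, rfl⟩
    exact ⟨β, α, (hh β α).trans hm, rfl⟩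

theorem eventually_agreeBelow (n : ℕ) (x : ℕ → Bool) : ∀ᶠ y in 𝓝 x, AgreeBelow n y x := by
  have : ∀ i, ∀ᶠ y in 𝓝 x, y i = x i := fun i =>
    (continuous_apply i).continuousAt.preimage_mem_nhds
      ((isOpen_discrete {x i}).mem_nhds rfl)
  have := (Filter.eventually_all_finset (Finset.range n)).2 fun i _ => this i
  filter_upwards [this] with y hy i hi
  exact hy i (Finset.mem_range.2 hi)

theorem exists_agreeBelow_of_mem_colourClosure {h : M → M → ℕ} {m : ℕ} {x y : ℕ → Bool}
    (hxy : (x, y) ∈ colourClosure s h m) (n : ℕ) :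
    ∃ α β, h α β = m ∧ AgreeBelow n (s α) x ∧ AgreeBelow n (s β) y := by
  have := mem_closure_iff_nhds.1 hxy _
    (prod_mem_nhds (eventually_agreeBelow n x) (eventually_agreeBelow n y))
  obtain ⟨_, ⟨h1, h2⟩, α, β, hm, rfl⟩ := this
  exact ⟨α, β, hm, h1, h2⟩

namespace PairCondition

/-- The tuple `b` of elements of the domain of `p` realizes, up to the height of `p`, the
sequences `x` with the colours `m`. -/
structure Realizes (p : PairCondition s c) {k : ℕ} (b : Fin (k + 1) → M)
    (x : Fin (k + 1) → ℕ → Bool) (m : Fin (k + 1) → Fin (k + 1) → ℕ) : Prop where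
  mem : ∀ i, b i ∈ p.dom
  agree : ∀ i, AgreeBelow p.height (s (b i)) (x i)
  colour_eq : ∀ i j, i ≠ j → p.colour (b i) (b j) = m i j

/-- The height and the bound of `p` are large with respect to `x` and `m`. -/
structure Decides (p : PairCondition s c) {k : ℕ} (x : Fin (k + 1) → ℕ → Bool)
    (m : Fin (k + 1) → Fin (k + 1) → ℕ) : Prop where
  lt_bound : ∀ i j, i ≠ j → m i j < p.bound
  not_agree : ∀ i j, i ≠ j → ¬ AgreeBelow p.height (x i) (x j)

variable {p q : PairCondition s c} {k : ℕ} {x : Fin (k + 1) → ℕ → Bool}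
  {m : Fin (k + 1) → Fin (k + 1) → ℕ}

theorem Decides.mono (h : p.Decides x m) (hpq : p ≤ q) : q.Decides x m :=
  ⟨fun i j hij => (h.lt_bound i j hij).trans_le hpq.bound,
    fun i j hij h' => h.not_agree i j hij (h'.mono hpq.height)⟩

theorem exists_decides {G : Order.Ideal (PairCondition s c)}
    (hG : ∀ N, ∃ p ∈ G, N ≤ p.height ∧ N ≤ p.bound) (hx : Function.Injective x)
    (m : Fin (k + 1) → Fin (k + 1) → ℕ) : ∃ p ∈ G, p.Decides x m := by
  obtain ⟨n, hn⟩ := Finset.univ.exists_agreeBelow_imp_eq hx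
  obtain ⟨p, hp, h1, h2⟩ := hG (max n (Finset.univ.sup (fun z : Fin (k + 1) × Fin (k + 1) =>
    m z.1 z.2) + 1))
  refine ⟨p, hp, fun i j _ => ?_, fun i j hij h => hij (hn i (by simp) j (by simp) (h.mono ?_))⟩
  · have := Finset.le_sup (f := fun z : Fin (k + 1) × Fin (k + 1) => m z.1 z.2)
      (Finset.mem_univ (i, j))
    simp only at this
    omega
  · omega

/-- Two tuples realizing the same configuration have the same colour. -/
theorem Realizes.tuple_eq (hpq : p ≤ q) (hk : 1 ≤ k) (hd : p.Decides x m)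
    {a b : Fin (k + 1) → M} (hb : p.Realizes b x m) (hmem : ∀ i, a i ∈ q.dom)
    (hagree : ∀ i, AgreeBelow p.height (s (a i)) (x i))
    (hcol : ∀ i j, i ≠ j → q.colour (a i) (a j) = m i j) : c k a = c k b := by
  obtain ⟨b', hb'⟩ := hpq.exists_copy k a hk hmem
    (fun i j hij => (hcol i j hij).trans_lt (hd.lt_bound i j hij))
    (fun i j hij h => hd.not_agree i j hij (((hagree i).symm.trans h).trans (hagree j)))
  -- Elements of `p.dom` are determined by their restrictions to `p.height`.
  have : b' = b := funext fun i => p.eq_of_agree _ (hb'.mem i) _ (hb.mem i)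
    (((hb'.agree i).trans (hagree i)).trans (hb.agree i).symm)
  rw [← hb'.tuple_eq, this]

theorem Realizes.injective {b : Fin (k + 1) → M} (hd : p.Decides x m) (hb : p.Realizes b x m) :
    Function.Injective b := by
  intro i j hij
  by_contra hne
  exact hd.not_agree i j hne ((hij ▸ (hb.agree i)).symm.trans (hb.agree j))

/-- Each pair is approximated by a pair from `M` of the right colour, which `exists_copy` moves into
`p.dom`. Restrictions to `p.height` determine elements of `p.dom`, so the copies of different pairs
fit together into one tuple. -/
theorem exists_realizes {G : Order.Ideal (PairCondition s c)} (hG : ∀ α, ∃ p ∈ G, α ∈ p.dom)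
    {h : M → M → ℕ} (hh : ∀ p ∈ G, ∀ α ∈ p.dom, ∀ β ∈ p.dom, h α β = p.colour α β)
    (hp : p ∈ G) (hk : 1 ≤ k) (hd : p.Decides x m)
    (hx : ∀ i j, i ≠ j → (x i, x j) ∈ colourClosure s h (m i j)) :
    ∃ b, p.Realizes b x m := by
  have pair : ∀ i j, i ≠ j → ∃ α ∈ p.dom, ∃ β ∈ p.dom, AgreeBelow p.height (s α) (x i) ∧
      AgreeBelow p.height (s β) (x j) ∧ p.colour α β = m i j := by
    intro i j hij
    obtain ⟨α, β, hαβ, hα, hβ⟩ := exists_agreeBelow_of_mem_colourClosure (hx i j hij) p.height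
    obtain ⟨q₁, hq₁, hα₁⟩ := hG α
    obtain ⟨q₂, hq₂, hβ₂⟩ := hG β
    obtain ⟨q₃, hq₃, h₁₃, h₂₃⟩ := G.directed q₁ hq₁ q₂ hq₂
    obtain ⟨q, hq, h₃, hpq⟩ := G.directed q₃ hq₃ p hp
    have hαq : α ∈ q.dom := h₃.dom (h₁₃.dom hα₁)
    have hβq : β ∈ q.dom := h₃.dom (h₂₃.dom hβ₂)
    have hcol : q.colour α β = m i j := (hh q hq α hαq β hβq).symm.trans hαβ
    have hcol' : q.colour β α = m i j := (q.colour_symm β α).trans hcol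
    have hlt := hd.lt_bound i j hij
    have hsep : ¬ AgreeBelow p.height (s α) (s β) := fun h' =>
      hd.not_agree i j hij ((hα.symm.trans h').trans hβ)
    obtain ⟨b, hb⟩ := hpq.exists_copy 1 ![α, β] le_rfl
      (by simp [Fin.forall_fin_two, hαq, hβq])
      (by simp [Fin.forall_fin_two, hcol, hcol', hlt])
      (by simpa [Fin.forall_fin_two, hsep] using fun h' => hsep h'.symm)
    refine ⟨b 0, hb.mem 0, b 1, hb.mem 1, (hb.agree 0).trans hα, (hb.agree 1).trans hβ, ?_⟩
    rw [hb.colour_eq 0 1 (by simp)]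
    exact hcol
  have : ∀ i, ∃ α ∈ p.dom, AgreeBelow p.height (s α) (x i) := by
    intro i
    have : Nontrivial (Fin (k + 1)) := Fin.nontrivial_iff_two_le.2 (by omega)
    obtain ⟨j, hj⟩ := exists_ne i
    obtain ⟨α, hα, β, -, h1, -⟩ := pair i j hj.symm
    exact ⟨α, hα, h1⟩
  choose b hb hbx using this
  refine ⟨b, hb, hbx, fun i j hij => ?_⟩
  obtain ⟨α, hα, β, hβ, h1, h2, h3⟩ := pair i j hij
  rw [p.eq_of_agree _ (hb i) _ hα ((hbx i).trans h1.symm),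
    p.eq_of_agree _ (hb j) _ hβ ((hbx j).trans h2.symm), h3]

end PairCondition

open PairCondition

/-- A tuple of minimal rank which is realized by a generic tuple of a perfect clique could be
extended to one of smaller rank. -/
theorem no_perfect_clique {G : Order.Ideal (PairCondition s c)} (hG : ∀ α, ∃ p ∈ G, α ∈ p.dom)
    (hG' : ∀ N, ∃ p ∈ G, N ≤ p.height ∧ N ≤ p.bound) {h : M → M → ℕ}
    (hsymm : ∀ α β, h α β = h β α)
    (hh : ∀ p ∈ G, ∀ α ∈ p.dom, ∀ β ∈ p.dom, h α β = p.colour α β)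
    {pos : ∀ k, ℕ → Fin (k + 1)} {ρ : ℕ → ℕ → Ordinal.{0}} (hc : IsRankColouring c pos ρ)
    {Q : Type*} [TopologicalSpace Q] [CompactSpace Q] [T2Space Q] [SecondCountableTopology Q]
    [hQ : ∀ x : Q, (𝓝[≠] x).NeBot] [Nonempty Q] {f : Q → ℕ → Bool} (hf : Continuous f)
    (hinj : Function.Injective f)
    (hcover : ∀ x y, x ≠ y → ∃ m, (f x, f y) ∈ colourClosure s h m) : False := by
  set F : ℕ → Set (Q × Q) := fun m => {z | (f z.1, f z.2) ∈ colourClosure s h m} with hF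
  have hFc : ∀ m, IsClosed (F m) := fun m =>
    (isClosed_colourClosure h m).preimage (by fun_prop : Continuous fun z : Q × Q => (f z.1, f z.2))
  have hFs : ∀ m x y, (x, y) ∈ F m → (y, x) ∈ F m := fun m x y hxy =>
    colourClosure_symm hsymm hxy
  have hdense := dense_iUnion_interior_of_forall_ne hFc hcover
  obtain ⟨Y, hYd, hY⟩ := exists_dense_forall_dense_section
    (isOpen_iUnion fun m => isOpen_interior) hdense
  have hFx : ∀ {k : ℕ} {y : Fin (k + 1) → Q} {m}, IsGenericTuple F Y y m →
      ∀ i j, i ≠ j → (f (y i), f (y j)) ∈ colourClosure s h (m i j) :=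
    fun {k y m} hy i j hij => interior_subset (s := F (m i j)) (hy.pair_mem i j hij)
  have hyinj : ∀ {k : ℕ} {y : Fin (k + 1) → Q} {m}, IsGenericTuple F Y y m →
      Function.Injective fun i => f (y i) := fun hy => hinj.comp hy.injective
  -- The ordinals of tuples of length at least two that realize generic tuples of the clique; a
  -- tuple attaining the least one will be extended.
  set S : Set Ordinal.{0} := {o | ∃ (k : ℕ) (y : Fin (k + 1) → Q) (m : _) (p : _) (b : _), 1 ≤ k ∧
    IsGenericTuple F Y y m ∧ p ∈ G ∧ p.Decides (fun i => f (y i)) m ∧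
    p.Realizes b (fun i => f (y i)) m ∧ o = ρ k (c k b)} with hS
  have hSn : S.Nonempty := by
    obtain ⟨y₀, hy₀⟩ := hYd.nonempty
    have h₀ : IsGenericTuple F Y (fun _ : Fin 1 => y₀) (fun _ _ => 0) :=
      ⟨fun i j _ => Fin.ext (by omega), fun _ => hy₀,
        fun i j hij => absurd (Fin.ext (by omega)) hij⟩
    obtain ⟨y', -, m, hm, -⟩ := h₀.exists_snoc hFs hYd hY 0 Filter.univ_mem
    obtain ⟨p, hp, hd⟩ := exists_decides hG' (hyinj hm) m
    obtain ⟨b, hb⟩ := exists_realizes hG hh hp le_rfl hd (hFx hm)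
    exact ⟨_, _, _, _, p, b, le_rfl, hm, hp, hd, hb, rfl⟩
  obtain ⟨k, y, m, p, b, hk, hy, hp, hd, hb, ho⟩ := csInf_mem hSn
  set i₀ := pos k (c k b) with hi₀
  -- Since `y'` agrees with `y i₀` up to `p.height`, the condition `p` cannot distinguish between
  -- them. Hence `d`, and also `d` with its distinguished entry replaced by `a`, receive the tuple
  -- colour of `b`.
  obtain ⟨y', hy'V, m', hm', hmm, hmi⟩ := hy.exists_snoc hFs hYd hY i₀
    (hf.continuousAt.eventually (eventually_agreeBelow p.height (f (y i₀))))
  obtain ⟨q₁, hq₁, hd₁⟩ := exists_decides hG' (hyinj hm') m'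
  obtain ⟨q, hq, hq₁q, hpq⟩ := G.directed q₁ hq₁ p hp
  have hdq := hd₁.mono hq₁q
  obtain ⟨b', hb'⟩ := exists_realizes hG hh hq (hk.trans (Nat.le_succ k)) hdq (hFx hm')
  set d : Fin (k + 1) → M := fun i => b' i.castSucc with hd'
  set a := b' (Fin.last _) with ha
  have hb'inj : Function.Injective b' := hb'.injective hdq
  have hdinj : Function.Injective d := hb'inj.comp (Fin.castSucc_injective _)
  have had : a ∉ Set.range d := by
    rintro ⟨i, hi⟩
    exact (Fin.castSucc_lt_last i).ne (hb'inj hi)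
  have hagree : ∀ i, AgreeBelow p.height (s (d i)) (f (y i)) := by
    intro i
    have := (hb'.agree i.castSucc).mono hpq.height
    simpa using this
  have hagree' : AgreeBelow p.height (s a) (f (y i₀)) := by
    have := (hb'.agree (Fin.last _)).mono hpq.height
    simp only [Fin.snoc_last] at this
    exact this.trans hy'V
  have hcd : c k d = c k b := by
    refine Realizes.tuple_eq hpq hk hd hb (fun i => hb'.mem _) hagree fun i j hij => ?_
    rw [hb'.colour_eq _ _ (by simpa using hij), hmm]
  have hcu : c k (Function.update d i₀ a) = c k b := by
    refine Realizes.tuple_eq hpq hk hd hb (fun i => ?_) (fun i => ?_) fun i j hij => ?_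
    · by_cases hi : i = i₀
      · subst hi; simpa using hb'.mem _
      · simpa [hi] using hb'.mem _
    · by_cases hi : i = i₀
      · rw [hi]; simpa using hagree'
      · simpa [hi] using hagree i
    · by_cases hi : i = i₀
      · have hj : j ≠ i₀ := fun hj => hij (hi.trans hj.symm)
        rw [hi, Function.update_self, Function.update_of_ne hj, ← (hmi j hj).1]
        exact hb'.colour_eq _ _ (Fin.castSucc_lt_last j).ne'
      · by_cases hj : j = i₀
        · rw [hj, Function.update_self, Function.update_of_ne hi, ← (hmi i hi).2]
          exact hb'.colour_eq _ _ (Fin.castSucc_lt_last i).ne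
        · rw [Function.update_of_ne hi, Function.update_of_ne hj,
            hb'.colour_eq _ _ (by simpa using hij), hmm]
  have hlt := hc k d hdinj a had (by rw [hcd, ← hi₀, hcu])
  have hsnoc : (Fin.snoc d a : Fin (k + 2) → M) = b' := Fin.snoc_init_self b'
  rw [hsnoc, hcd, ← ho] at hlt
  exact absurd (csInf_le' (s := S) ⟨k + 1, _, m', q, b', hk.trans (Nat.le_succ k), hm', hq, hdq,
    hb', rfl⟩) (not_le.2 hlt)

/-- Under Martin's axiom, if there is a rank colouring of `M`, then there is an `F_σ` symmetric
relation on the Cantor space which has a clique of size `#M` but no perfect clique. -/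
theorem MartinsAxiom.exists_relation (hMA : MartinsAxiom) [Nonempty M] (hM : #M < 𝔠)
    {pos : ∀ k, ℕ → Fin (k + 1)} {ρ : ℕ → ℕ → Ordinal.{0}} (hc : IsRankColouring c pos ρ) :
    ∃ (F : ℕ → Set ((ℕ → Bool) × (ℕ → Bool))) (s : M → ℕ → Bool), (∀ m, IsClosed (F m)) ∧
      (∀ m x y, (x, y) ∈ F m → (y, x) ∈ F m) ∧ Function.Injective s ∧
      (∀ α β, ∃ m, (s α, s β) ∈ F m) ∧
      ∀ (Q : Type) [TopologicalSpace Q] [CompactSpace Q] [T2Space Q] [SecondCountableTopology Q]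
        [∀ x : Q, (𝓝[≠] x).NeBot] [Nonempty Q] (f : Q → ℕ → Bool), Continuous f →
        Function.Injective f → ¬ ∀ x y, x ≠ y → ∃ m, (f x, f y) ∈ F m := by
  obtain ⟨s, hs⟩ : ∃ s : M → ℕ → Bool, Function.Injective s := by
    have : #M ≤ #(ℕ → Bool) := by simpa using hM.le
    obtain ⟨e⟩ := this
    exact ⟨e, e.injective⟩
  obtain ⟨G, hG, hG'⟩ := hMA.exists_generic s c hM hs
  obtain ⟨h, hsymm, hh⟩ := exists_generic_colouring hG
  exact ⟨colourClosure s h, s, isClosed_colourClosure h, fun m x y => colourClosure_symm hsymm, hs,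
    fun α β => ⟨_, mem_colourClosure h α β⟩, fun Q _ _ _ _ _ _ f hf hinj hcover =>
      no_perfect_clique hG hG' hsymm hh hc hf hinj hcover⟩

end Clique

/-! ### Independent compact families and sets with prescribed pairwise sums. -/

section Independent

open Topology

/-- A compact second countable totally disconnected space embeds in the Cantor space as a linearly
independent set. -/
theorem exists_continuous_linearIndependent (Z : Type*) [TopologicalSpace Z] [CompactSpace Z]
    [T2Space Z] [TotallyDisconnectedSpace Z] [SecondCountableTopology Z] :
    ∃ E : Z → CantorGroup, Continuous E ∧ LinearIndependent (ZMod 2) E := by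
  classical
  have hc : Countable (TopologicalSpace.Clopens Z) :=
    TopologicalSpace.Clopens.countable_iff_secondCountable.2 inferInstance
  obtain ⟨e, he⟩ := exists_injective_nat (TopologicalSpace.Clopens Z)
  -- The coordinates are the indicators of the countably many clopen sets; numbers coding no clopen
  -- set give the coordinate 0.
  refine ⟨fun z n => if ∃ U, e U = n ∧ z ∈ U then 1 else 0, ?_, ?_⟩
  · refine continuous_pi fun n => ?_
    by_cases hn : ∃ U, e U = n
    · obtain ⟨U, rfl⟩ := hn
      have : ∀ z, (∃ V, e V = e U ∧ z ∈ V) ↔ z ∈ (U : Set Z) := fun z =>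
        ⟨fun ⟨V, hV, hz⟩ => he hV ▸ hz, fun hz => ⟨U, rfl, hz⟩⟩
      simp only [this]
      refine continuous_const.if (fun z hz => ?_) continuous_const
      rw [Set.ofPred_mem_eq, U.isClopen.frontier_eq] at hz
      exact absurd hz (Set.notMem_empty z)
    · have : ∀ z, ¬ ∃ V, e V = n ∧ z ∈ V := fun z ⟨V, hV, _⟩ => hn ⟨V, hV⟩
      simp only [this, if_false]
      exact continuous_const
  · rw [linearIndependent_iff']
    intro s g hg i hi
    -- A clopen set isolating `i` from the rest of `s` gives a coordinate in which only the
    -- coefficient of `i` survives.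
    obtain ⟨V, hV, hiV, hVs⟩ := compact_exists_isClopen_in_isOpen
      (((s.erase i).finite_toSet.isClosed.isOpen_compl) : IsOpen ((s.erase i : Set Z)ᶜ))
      (x := i) (by simp)
    have := congrFun hg (e ⟨V, hV⟩)
    rw [Finset.sum_apply, Finset.sum_eq_single_of_mem i hi] at this
    · have h1 : ∃ U, e U = e ⟨V, hV⟩ ∧ i ∈ U := ⟨⟨V, hV⟩, rfl, hiV⟩
      simpa [h1] using this
    · intro j hj hji
      have h1 : ¬ ∃ U, e U = e ⟨V, hV⟩ ∧ j ∈ U := by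
        rintro ⟨U, hU, hjU⟩
        rw [he hU] at hjU
        exact hVs hjU (by simp [hj, hji])
      simp [h1]

theorem CantorGroup.add_self (x : CantorGroup) : x + x = 0 := CharTwo.add_self_eq_zero x

theorem CantorGroup.add_eq_iff {x y z : CantorGroup} : x + y = z ↔ x = y + z := by
  constructor
  · rintro rfl
    rw [add_left_comm, CantorGroup.add_self, add_zero]
  · rintro rfl
    rw [add_right_comm, CantorGroup.add_self, zero_add]

variable {T : Type*} {u : T → CantorGroup}

open Classical in
theorem LinearIndependent.pair_eq_pair (hu : LinearIndependent (ZMod 2) u) {a b c d : T}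
    (hab : a ≠ b) (h : u a + u b = u c + u d) : a = c ∧ b = d ∨ a = d ∧ b = c := by
  have h' : Finsupp.single a (1 : ZMod 2) + Finsupp.single b 1 =
      Finsupp.single c 1 + Finsupp.single d 1 := by
    refine hu ?_
    simpa using h
  have ha := DFunLike.congr_fun h' a
  have hb := DFunLike.congr_fun h' b
  simp only [Finsupp.add_apply, Finsupp.single_apply] at ha hb
  grind

-- Two disjoint pairs would leave four nonzero coefficients on the left, while the right side has at
-- most two.
open Classical in
theorem LinearIndependent.not_disjoint_pairs (hu : LinearIndependent (ZMod 2) u) {a b c d e f : T}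
    (hab : a ≠ b) (hcd : c ≠ d) (h : u a + u b + (u c + u d) = u e + u f) :
    a = c ∨ a = d ∨ b = c ∨ b = d := by
  have h' : Finsupp.single a (1 : ZMod 2) + Finsupp.single b 1 +
      (Finsupp.single c 1 + Finsupp.single d 1) = Finsupp.single e 1 + Finsupp.single f 1 := by
    refine hu ?_
    simpa using h
  have ha := DFunLike.congr_fun h' a
  have hb := DFunLike.congr_fun h' b
  have hc := DFunLike.congr_fun h' c
  simp only [Finsupp.add_apply, Finsupp.single_apply] at ha hb hc
  grind

/-- A large set whose pairwise sums are sums of two members of an independent family is contained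
in a translation of this family. -/
theorem LinearIndependent.exists_translation (hu : LinearIndependent (ZMod 2) u)
    {P : Set CantorGroup} (hP : P.Infinite)
    (h : ∀ x ∈ P, ∀ y ∈ P, x ≠ y → ∃ s t, s ≠ t ∧ x + y = u s + u t) :
    ∃ g, ∀ x ∈ P, ∃ t, x = g + u t := by
  classical
  obtain ⟨p₀, hp₀, -⟩ := hP.exists_notMem_finset ∅
  obtain ⟨p₁, hp₁, hp₁'⟩ := hP.exists_notMem_finset {p₀}
  obtain ⟨p₂, hp₂, hp₂'⟩ := hP.exists_notMem_finset {p₀, p₁}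
  simp only [Finset.mem_singleton, Finset.mem_insert, not_or] at hp₁' hp₂'
  have sum : ∀ x y : CantorGroup, x + y = (p₀ + x) + (p₀ + y) := fun x y => by
    rw [add_add_add_comm, CantorGroup.add_self, zero_add]
  -- The pairs representing the sums `p₀ + x` meet one another. Such a family is a star or a
  -- triangle: a pair meeting `{a, b}` and `{a, c}` contains `a` or equals `{b, c}`.
  have meet : ∀ x ∈ P, ∀ y ∈ P, x ≠ y → ∀ a b c d, a ≠ b → c ≠ d → p₀ + x = u a + u b →
      p₀ + y = u c + u d → a = c ∨ a = d ∨ b = c ∨ b = d := by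
    intro x hx y hy hxy a b c d hab hcd h1 h2
    obtain ⟨e, f, -, hef⟩ := h x hx y hy hxy
    rw [sum, h1, h2] at hef
    exact hu.not_disjoint_pairs hab hcd hef
  obtain ⟨a, b, c, hab, hac, hbc, h1, h2⟩ : ∃ a b c, a ≠ b ∧ a ≠ c ∧ b ≠ c ∧
      p₀ + p₁ = u a + u b ∧ p₀ + p₂ = u a + u c := by
    obtain ⟨a, b, hab, h1⟩ := h p₀ hp₀ p₁ hp₁ (Ne.symm hp₁')
    obtain ⟨c, d, hcd, h2⟩ := h p₀ hp₀ p₂ hp₂ (Ne.symm hp₂'.1)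
    have hne : p₀ + p₁ ≠ p₀ + p₂ := fun h => hp₂'.2 (add_left_cancel h).symm
    rcases meet p₁ hp₁ p₂ hp₂ (Ne.symm hp₂'.2) a b c d hab hcd h1 h2 with rfl | rfl | rfl | rfl
    · exact ⟨a, b, d, hab, hcd, fun h => hne (by rw [h1, h2, h]), h1, h2⟩
    · exact ⟨a, b, c, hab, hcd.symm, fun h => hne (by rw [h1, h2, h, add_comm]), h1,
        h2.trans (add_comm _ _)⟩
    · exact ⟨b, a, d, hab.symm, hcd, fun h => hne (by rw [h1, h2, h, add_comm]),
        h1.trans (add_comm _ _), h2⟩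
    · exact ⟨b, a, c, hab.symm, hcd.symm, fun h => hne (by rw [h1, h2, h]),
        h1.trans (add_comm _ _), h2.trans (add_comm _ _)⟩
  have form : ∀ x, ∀ t, p₀ + x = u a + u t → x = p₀ + u a + u t := by
    intro x t hx
    rw [add_assoc, ← hx, ← add_assoc, CantorGroup.add_self, zero_add]
  have main : ∀ x ∈ P, x ≠ p₀ + (u b + u c) → ∃ t, x = p₀ + u a + u t := by
    intro x hx hne
    by_cases hx₀ : x = p₀
    · exact ⟨a, by rw [hx₀, add_assoc, CantorGroup.add_self, add_zero]⟩
    by_cases hx₁ : x = p₁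
    · exact ⟨b, form x b (hx₁ ▸ h1)⟩
    by_cases hx₂ : x = p₂
    · exact ⟨c, form x c (hx₂ ▸ h2)⟩
    obtain ⟨d, f, hdf, h3⟩ := h p₀ hp₀ x hx (Ne.symm hx₀)
    by_cases hd : d = a
    · exact ⟨f, form x f (hd ▸ h3)⟩
    by_cases hf : f = a
    · exact ⟨d, form x d (by rw [h3, hf, add_comm])⟩
    have hb := meet x hx p₁ hp₁ hx₁ d f a b hdf hab h3 h1
    have hc := meet x hx p₂ hp₂ hx₂ d f a c hdf hac h3 h2
    refine absurd ?_ hne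
    have : p₀ + x = u b + u c := by
      rw [h3]
      have : d = b ∧ f = c ∨ d = c ∧ f = b := by grind
      rcases this with ⟨rfl, rfl⟩ | ⟨rfl, rfl⟩
      · rfl
      · exact add_comm _ _
    rw [← this, ← add_assoc, CantorGroup.add_self, zero_add]
  refine ⟨p₀ + u a, fun x hx => main x hx ?_⟩
  rintro rfl
  -- A further point has a pair `{a, t}` with `t` different from `b` and `c`; it misses `{b, c}`,
  -- which rules out the triangle.
  obtain ⟨p₃, hp₃, hp₃'⟩ := hP.exists_notMem_finset {p₀, p₁, p₂, p₀ + (u b + u c)}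
  simp only [Finset.mem_singleton, Finset.mem_insert, not_or] at hp₃'
  obtain ⟨t, ht⟩ := main p₃ hp₃ hp₃'.2.2.2
  have hta : a ≠ t := by
    rintro rfl
    exact hp₃'.1 (by rw [ht, add_assoc, CantorGroup.add_self, add_zero])
  have ht' : p₀ + p₃ = u a + u t := by
    rw [ht, ← add_assoc, ← add_assoc, CantorGroup.add_self, zero_add]
  rcases meet p₃ hp₃ _ hx (hp₃'.2.2.2) a t b c hta hbc ht'
    (by rw [← add_assoc, CantorGroup.add_self, zero_add]) with h | h | h | h
  · exact hab h
  · exact hac h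
  · exact hp₃'.2.1 (by rw [ht, h, ← form p₁ b h1])
  · exact hp₃'.2.2.1 (by rw [ht, h, ← form p₂ c h2])

end Independent

/-! ### The set attached to a relation and its translations. -/

section Translations

open Topology

/-- The space which indexes the independent family: a copy of the Cantor space, and a copy of its
square for each element of `I`. -/
abbrev TranslationIndex (I : Type) : Type := (ℕ → Bool) ⊕ (I × (ℕ → Bool) × (ℕ → Bool))

variable {I : Type} (E : TranslationIndex I → CantorGroup)

/-- The points `c` and `c + x_s + x_t`, where `c` is attached to the index `i` and the
pair `(s, t)`. -/
def translationPoint (l : I × (ℕ → Bool) × (ℕ → Bool)) (ε : ZMod 2) : CantorGroup :=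
  E (Sum.inr l) + ε • (E (Sum.inl l.2.1) + E (Sum.inl l.2.2))

/-- The set of all points attached to the elements of the relation `R`. -/
def translationSet (R : Set ((ℕ → Bool) × (ℕ → Bool))) : Set CantorGroup :=
  {b | ∃ i, ∃ z ∈ R, ∃ ε, b = translationPoint E (i, z) ε}

variable {E}

theorem isSigmaZeroTwo_translationSet [TopologicalSpace I] [CompactSpace I] (hE : Continuous E)
    {F : ℕ → Set ((ℕ → Bool) × (ℕ → Bool))} (hF : ∀ m, IsClosed (F m)) :
    IsSigmaZeroTwo (translationSet E (⋃ m, F m)) := by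
  refine ⟨fun m => (fun x : I × ((ℕ → Bool) × (ℕ → Bool)) × ZMod 2 =>
    translationPoint E (x.1, x.2.1) x.2.2) '' (Set.univ ×ˢ (F m ×ˢ Set.univ)), fun m => ?_, ?_⟩
  · refine IsCompact.isClosed ((isCompact_univ.prod ((hF m).isCompact.prod isCompact_univ)).image ?_)
    unfold translationPoint
    have h1 : Continuous fun x : I × ((ℕ → Bool) × (ℕ → Bool)) × ZMod 2 =>
        E (Sum.inr (x.1, x.2.1)) := hE.comp (by fun_prop)
    have h2 : Continuous fun x : I × ((ℕ → Bool) × (ℕ → Bool)) × ZMod 2 =>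
        E (Sum.inl x.2.1.1) := hE.comp (by fun_prop)
    have h3 : Continuous fun x : I × ((ℕ → Bool) × (ℕ → Bool)) × ZMod 2 =>
        E (Sum.inl x.2.1.2) := hE.comp (by fun_prop)
    have h4 : Continuous fun x : I × ((ℕ → Bool) × (ℕ → Bool)) × ZMod 2 => x.2.2 := by fun_prop
    exact h1.add (h4.smul (h2.add h3))
  · ext b
    simp only [translationSet, Set.mem_ofPred_eq, Set.mem_iUnion, Set.mem_image, Set.mem_prod,
      Set.mem_univ, true_and, and_true, Prod.exists]
    constructor
    · rintro ⟨i, s, t, ⟨m, hm⟩, ε, rfl⟩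
      exact ⟨m, i, s, t, ε, hm, rfl⟩
    · rintro ⟨m, i, s, t, ε, hm, rfl⟩
      exact ⟨i, s, t, ⟨m, hm⟩, ε, rfl⟩

-- Coefficients at the c-points alone decide this: `k ≠ k'` leaves two of them on the right, and the
-- left must produce the same two.
open Classical in
theorem translationPoint_add_eq (hE : LinearIndependent (ZMod 2) E)
    {l l' k k' : I × (ℕ → Bool) × (ℕ → Bool)} {ε ε' δ δ' : ZMod 2}
    (h : translationPoint E l ε + translationPoint E l' ε' =
      translationPoint E k δ + translationPoint E k' δ') (hk : k ≠ k') : l = k ∨ l = k' := by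
  let lift : I × (ℕ → Bool) × (ℕ → Bool) → ZMod 2 → TranslationIndex I →₀ ZMod 2 := fun l ε =>
    Finsupp.single (Sum.inr l) 1 +
      ε • (Finsupp.single (Sum.inl l.2.1) 1 + Finsupp.single (Sum.inl l.2.2) 1)
  have h' : lift l ε + lift l' ε' = lift k δ + lift k' δ' := by
    refine hE ?_
    simpa [lift, translationPoint] using h
  have hev : ∀ y, (if l = y then (1 : ZMod 2) else 0) + (if l' = y then 1 else 0) =
      (if k = y then 1 else 0) + (if k' = y then 1 else 0) := by
    intro y
    have := DFunLike.congr_fun h' (Sum.inr y)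
    simpa [lift, Finsupp.single_apply] using this
  have h1 := hev l
  have h2 := hev k
  grind

/-- If `z ≠ 0` is in many ways the sum of two elements of the set attached to `R`, then `z` is
the sum `x_s + x_t` for some `(s, t) ∈ R`. -/
theorem exists_pair_of_lt_mk (hE : LinearIndependent (ZMod 2) E)
    {R : Set ((ℕ → Bool) × (ℕ → Bool))} {z : CantorGroup} (hz : z ≠ 0)
    (hS : 4 < #{b | b ∈ translationSet E R ∧ b + z ∈ translationSet E R}) :
    ∃ s t, (s, t) ∈ R ∧ s ≠ t ∧ z = E (Sum.inl s) + E (Sum.inl t) := by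
  classical
  by_contra hcon
  have hε : ∀ δ : ZMod 2, δ = 0 ∨ δ = 1 := by decide
  -- If both summands carried the same label, its c-point would cancel and leave 0 or x_s + x_t.
  -- With distinct labels, `z` determines the two labels, and each carries two points: hence the
  -- bound four.
  have hlab : ∀ l ε l' ε', l.2 ∈ R → translationPoint E l ε + translationPoint E l' ε' = z →
      l ≠ l' := by
    rintro l ε l' ε' hl hsum rfl
    have hz' : z = (ε + ε') • (E (Sum.inl l.2.1) + E (Sum.inl l.2.2)) := by
      rw [← hsum, translationPoint, translationPoint, add_add_add_comm, CantorGroup.add_self,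
        zero_add, add_smul]
    rcases hε (ε + ε') with h0 | h1
    · exact hz (by rw [hz', h0, zero_smul])
    · rw [h1, one_smul] at hz'
      refine hcon ⟨l.2.1, l.2.2, hl, fun hst => hz ?_, hz'⟩
      rw [hz', hst, CantorGroup.add_self]
  have hsub : ∃ T : Finset CantorGroup, T.card ≤ 4 ∧
      {b | b ∈ translationSet E R ∧ b + z ∈ translationSet E R} ⊆ T := by
    by_cases hne : {b | b ∈ translationSet E R ∧ b + z ∈ translationSet E R}.Nonempty
    · obtain ⟨b₀, ⟨i, w, hw, δ, h1⟩, ⟨i', w', hw', δ', h2⟩⟩ := hne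
      have hz₀ : translationPoint E (i, w) δ + translationPoint E (i', w') δ' = z := by
        rw [← h1, ← h2, ← add_assoc, CantorGroup.add_self, zero_add]
      have hk := hlab _ _ _ _ hw hz₀
      refine ⟨{translationPoint E (i, w) 0, translationPoint E (i, w) 1,
        translationPoint E (i', w') 0, translationPoint E (i', w') 1}, Finset.card_le_four, ?_⟩
      rintro b ⟨⟨j, v, hv, ε, h3⟩, ⟨j', v', hv', ε', h4⟩⟩
      have hz₁ : translationPoint E (j, v) ε + translationPoint E (j', v') ε' = z := by
        rw [← h3, ← h4, ← add_assoc, CantorGroup.add_self, zero_add]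
      rw [h3]
      rcases translationPoint_add_eq hE (hz₁.trans hz₀.symm) hk with h | h <;>
        rcases hε ε with rfl | rfl <;> simp [h]
    · exact ⟨∅, by simp, by rw [Set.not_nonempty_iff_eq_empty.1 hne]; simp⟩
  obtain ⟨T, hT, hsub⟩ := hsub
  refine absurd ((Cardinal.mk_le_mk_of_subset hsub).trans ?_) (not_le.2 hS)
  rw [Finset.coe_sort_coe, Cardinal.mk_coe_finset]
  exact_mod_cast hT

theorem mk_translation_inter_le (B : Set CantorGroup) (x y : CantorGroup) :
    #↥(translation B x ∩ translation B y) ≤ #{b | b ∈ B ∧ b + (x + y) ∈ B} := by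
  refine Cardinal.mk_le_of_injective (f := fun p => ⟨p.1 + x, ?_⟩) ?_
  · obtain ⟨p, ⟨b, hb, hbp⟩, ⟨b', hb', hbp'⟩⟩ := p
    have h1 : p + x = b := by
      rw [← hbp, add_assoc, CantorGroup.add_self, add_zero]
    have h2 : p + x + (x + y) = b' := by
      rw [← hbp', add_assoc, ← add_assoc x x y, CantorGroup.add_self, zero_add, add_assoc,
        CantorGroup.add_self, add_zero]
    exact ⟨h1 ▸ hb, h2 ▸ hb'⟩
  · rintro ⟨p, hp⟩ ⟨q, hq⟩ hpq
    simpa using hpq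

/-- For each index, c + x_s is also (c + x_s + x_t) + x_t. -/
theorem mk_le_mk_translation_inter (hE : LinearIndependent (ZMod 2) E)
    {R : Set ((ℕ → Bool) × (ℕ → Bool))} {s t : ℕ → Bool} (hst : (s, t) ∈ R) :
    #I ≤ #↥(translation (translationSet E R) (E (Sum.inl s)) ∩
      translation (translationSet E R) (E (Sum.inl t))) := by
  refine Cardinal.mk_le_of_injective (f := fun i =>
    ⟨translationPoint E (i, s, t) 0 + E (Sum.inl s), ⟨_, ⟨i, _, hst, 0, rfl⟩, rfl⟩,
      ⟨translationPoint E (i, s, t) 1, ⟨i, _, hst, 1, rfl⟩, ?_⟩⟩) ?_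
  · simp only [translationPoint, zero_smul, one_smul, add_zero]
    rw [add_assoc, add_assoc, CantorGroup.add_self, add_zero]
  · intro i j hij
    simp only [translationPoint, zero_smul, add_zero, Subtype.mk.injEq, add_left_inj] at hij
    simpa using hE.injective hij

theorem Perfect.neBot_nhdsNE {X : Type*} [TopologicalSpace X] {P : Set X} (hP : Perfect P)
    (x : P) : (𝓝[≠] x).NeBot := by
  rw [Filter.neBot_iff]
  intro h
  obtain ⟨U, hU, hUx⟩ := isOpen_induced_iff.1 ((isOpen_singleton_iff_punctured_nhds x).2 h)
  have hxU : (x : X) ∈ U := by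
    have : x ∈ ((↑) : P → X) ⁻¹' U := hUx ▸ rfl
    exact this
  obtain ⟨y, ⟨hyU, hyP⟩, hyx⟩ := preperfect_iff_nhds.1 hP.acc x x.2 U (hU.mem_nhds hxU)
  have : (⟨y, hyP⟩ : P) ∈ ((↑) : P → X) ⁻¹' U := hyU
  rw [hUx] at this
  exact hyx (congrArg Subtype.val (Set.mem_singleton_iff.1 this))

/-- A perfect set `P` of witnesses lies in a translate g + {x_t}. Pulling it back to the parameters
t gives a continuous injection, and independence identifies the pair of parameters with the pair
(s,t) in the relation up to order, so `P` would be a perfect clique. -/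
theorem isNPots_translationSet [TopologicalSpace I] (hEc : Continuous E) (hE : LinearIndependent (ZMod 2) E)
    {F : ℕ → Set ((ℕ → Bool) × (ℕ → Bool))} (hsymm : ∀ m x y, (x, y) ∈ F m → (y, x) ∈ F m)
    (hF : ∀ (Q : Type) [TopologicalSpace Q] [CompactSpace Q] [T2Space Q]
      [SecondCountableTopology Q] [∀ x : Q, (𝓝[≠] x).NeBot] [Nonempty Q] (f : Q → ℕ → Bool),
      Continuous f → Function.Injective f → ¬ ∀ x y, x ≠ y → ∃ m, (f x, f y) ∈ F m)
    {κ : Cardinal.{0}} (hκ : 4 < κ) : IsNPots κ (translationSet E (⋃ m, F m)) := by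
  rintro ⟨P, hP, hPn, hPκ⟩
  have hpair : ∀ x ∈ P, ∀ y ∈ P, x ≠ y → ∃ s t, (s, t) ∈ ⋃ m, F m ∧ s ≠ t ∧
      x + y = E (Sum.inl s) + E (Sum.inl t) := by
    intro x hx y hy hxy
    refine exists_pair_of_lt_mk hE (fun h => hxy ?_)
      (hκ.trans_le ((hPκ x hx y hy).trans (mk_translation_inter_le _ x y)))
    rwa [CantorGroup.add_eq_iff, add_zero] at h
  have hu : LinearIndependent (ZMod 2) fun t => E (Sum.inl t) := hE.comp _ Sum.inl_injective
  have huc : Continuous fun t => E (Sum.inl t) := hEc.comp continuous_inl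
  have hne : ∀ x : P, (𝓝[≠] x).NeBot := hP.neBot_nhdsNE
  have hnon : Nonempty P := hPn.to_subtype
  have hcomp : CompactSpace P := isCompact_iff_compactSpace.1 hP.closed.isCompact
  have hinf : P.Infinite := by
    rw [← Set.infinite_coe_iff, ← Set.infinite_univ_iff]
    exact infinite_of_mem_nhds (Classical.arbitrary P) Filter.univ_mem
  obtain ⟨g, hg⟩ := hu.exists_translation hinf fun x hx y hy hxy => by
    obtain ⟨s, t, -, hst, h⟩ := hpair x hx y hy hxy
    exact ⟨s, t, hst, h⟩
  choose f hf using fun x : P => hg x x.2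
  -- By compactness t ↦ x_t is an embedding, so `f` is continuous once its composite with this map,
  -- the translation by `g`, is.
  have hemb := (huc.isClosedEmbedding hu.injective).isInducing
  refine hF P f ?_ ?_ ?_
  · rw [hemb.continuous_iff]
    have : (fun t => E (Sum.inl t)) ∘ f = fun x : P => g + x := by
      funext x
      conv_rhs => rw [hf x]
      rw [← add_assoc, CantorGroup.add_self, zero_add]
      rfl
    rw [this]
    fun_prop
  · intro x y hxy
    exact Subtype.ext (by rw [hf x, hf y, hxy])
  · intro x y hxy
    have hfxy : f x ≠ f y := fun h => hxy (Subtype.ext (by rw [hf x, hf y, h]))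
    obtain ⟨s, t, hst, hne, h⟩ := hpair x x.2 y y.2 fun h => hxy (Subtype.ext h)
    rw [hf x, hf y, add_add_add_comm, CantorGroup.add_self, zero_add] at h
    obtain ⟨m, hm⟩ := Set.mem_iUnion.1 hst
    rcases hu.pair_eq_pair hfxy h with ⟨h1, h2⟩ | ⟨h1, h2⟩
    · exact ⟨m, by rw [h1, h2]; exact hm⟩
    · exact ⟨m, by rw [h1, h2]; exact hsymm m s t hm⟩

end Translations

/-! ### Assembling the theorem. -/

theorem corollary4p4 (hMA : MartinsAxiom) (hCH : ¬ ContinuumHypothesis)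
    (lam : Cardinal.{0}) (hlam : lam < 𝔠) (hNPr : NPr (ω₁ : Ordinal.{0}) lam)
    (ι : ℕ) (hι : 3 ≤ ι) :
    ∃ B : Set CantorGroup, IsSigmaZeroTwo B ∧ IsNPots ((2 * ι : ℕ) : Cardinal.{0}) B ∧
      HasManyNondisjointTranslations lam ((2 * ι : ℕ) : Cardinal.{0}) B := by
  have hmk : #lam.ord.ToType = lam := Cardinal.mk_ord_toType lam
  rcases isEmpty_or_nonempty lam.ord.ToType with hemp | hne
  · have h0 : lam = 0 := by rw [← hmk, Cardinal.mk_eq_zero]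
    refine ⟨∅, ⟨fun _ => ∅, fun _ => isClosed_empty, by simp⟩, ?_, ∅, by simp [h0], by simp⟩
    rintro ⟨P, -, ⟨x, hx⟩, h⟩
    have := h x hx x hx
    simp only [translation, Set.image_empty, Set.inter_self, Cardinal.mk_eq_zero,
      nonpos_iff_eq_zero, Nat.cast_eq_zero] at this
    omega
  obtain ⟨c, pos, ρ, hc⟩ := hNPr.exists_isRankColouring
  obtain ⟨F, s, hFc, hFs, hs, hclique, hF⟩ := hMA.exists_relation (hmk.trans_lt hlam) hc
  -- The `2 * ι` copies of the c-points provide the common points, and `3 ≤ ι` makes their number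
  -- exceed four.
  obtain ⟨E, hEc, hE⟩ := exists_continuous_linearIndependent (TranslationIndex (Fin (2 * ι)))
  refine ⟨translationSet E (⋃ m, F m), isSigmaZeroTwo_translationSet hEc hFc,
    isNPots_translationSet hEc hE hFs hF (by exact_mod_cast (by omega : 4 < 2 * ι)),
    Set.range fun α => E (Sum.inl (s α)), ?_, ?_⟩
  · rw [Cardinal.mk_range_eq (fun α => E (Sum.inl (s α))) ((hE.injective.comp Sum.inl_injective).comp hs), hmk]
  · rintro _ ⟨α, rfl⟩ _ ⟨β, rfl⟩
    have := mk_le_mk_translation_inter hE (Set.mem_iUnion.2 (hclique α β))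
    simpa using this
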